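/- Conventions. A hyperbolic space is a nonempty geodesic metric space $X$ (not necessarily proper or complete) for which there is $\delta\in\mathbb R$ with $(x|z)_o\ge\min\{(x|y)_o,(y|z)_o\}-\delta$ for all $o,x,y,z\in X$, where $(x|y)_o=\tfrac12(d(x,o)+d(y,o)-d(x,y))$. Its Gromov boundary $\partial X$ is the set of equivalence classes of sequences $(x_n)$ in $X$ with $(x_i|x_j)_o\to\infty$ as $i,j\to\infty$, where $(x_n)\sim(y_n)$ if $(x_n|y_n)_o\to\infty$. Let a group $G$ act on $X$ by isometries. The limit set $\Lambda(G)\subseteq\partial X$ consists of the classes of such sequences lying in an orbit $Gx$. The action is of general type if $\Lambda(G)$ is infinite and $G$ fixes no point of $\partial X$. An element $g\in G$ is loxodromic if $n\mapsto g^nx$, $n\in\mathbb Z$, is a quasi-isometric embedding for some (equivalently, every) $x\in X$. A group has (NGT) if none of its isometric actions on hyperbolic spaces is of general type. It has (NL) if none of its isometric actions on hyperbolic spaces has a loxodromic element, and hereditary (NL) if all its finite-index subgroups have (NL). A group is amenable if it carries a left-invariant finitely additive probability measure defined on all its subsets. In $\mathbb R\rtimes\mathbb Z/2\mathbb Z$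 the nontrivial element of $\mathbb Z/2\mathbb Z$ acts on $\mathbb R$ by $x\mapsto -x$. $\mathbb D_\infty$ denotes the infinite dihedral group. Proposition. Let $G$ be an amenable group. 1. $G$ has (NGT). 2. $G$ has (NL) if and only if every homomorphism $G\to\mathbb R\rtimes\mathbb Z/2\mathbb Z$ has image of order at most $2$. 3. $G$ has hereditary (NL) if and only if, for every finite-index subgroup $H\le G$, every homomorphism $H\to\mathbb R\rtimes\mathbb Z/2\mathbb Z$ has image of order at most $2$. 4. If $G$ is finitely generated, then $G$ has (NL) if and only if $G$ surjects neither onto $\mathbb Z$ nor onto $\mathbb D_\infty$; and $G$ has hereditary (NL) if and only if no finite-index subgroup of $G$ surjects onto $\mathbb Z$ or onto $\mathbb D_\infty$. Moreover: 5. An abelian group has (NL) if and only if it is a torsion group. 6. A nilpotent group has (NL) if and only if every homomorphism from it to $\mathbb R$ is trivial. -/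

import Mathlib

universe u v

/-! ### Geodesic Gromov-hyperbolic spaces -/

/-- The Gromov product `(x | y)_o = (d(x, o) + d(y, o) - d(x, y)) / 2`. -/
noncomputable def gromovProduct {X : Type v} [MetricSpace X] (o x y : X) : ℝ :=
  (dist x o + dist y o - dist x y) / 2

/-- A hyperbolic space: a nonempty geodesic metric space that is `δ`-hyperbolic for some `δ`
(Gromov's four-point inequality). Neither properness nor completeness is required. -/
class GeodesicHyperbolicSpace (X : Type v) [MetricSpace X] : Prop where
  nonempty : Nonempty X
  geodesic : ∀ x y : X, ∃ γ : ℝ → X, γ 0 = x ∧ γ (dist x y) = y ∧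
    ∀ s ∈ Set.Icc 0 (dist x y), ∀ t ∈ Set.Icc 0 (dist x y), dist (γ s) (γ t) = |s - t|
  hyperbolic : ∃ δ : ℝ, ∀ o x y z : X,
    min (gromovProduct o x y) (gromovProduct o y z) - δ ≤ gromovProduct o x z

/-! ### The Gromov boundary: classes of sequences convergent at infinity -/

/-- The sequence `x` converges at infinity: `(x_i | x_j)_o → ∞` as `i, j → ∞`. The condition does
not depend on the base point `o`. -/
def ConvergesAtInfinity {X : Type v} [MetricSpace X] (x : ℕ → X) : Prop :=
  ∀ o : X, Filter.Tendsto (fun p : ℕ × ℕ => gromovProduct o (x p.1) (x p.2))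
    Filter.atTop Filter.atTop

/-- Sequences convergent at infinity `x`, `y` are equivalent if `(x_n | y_n)_o → ∞`. -/
def boundarySetoid (X : Type v) [MetricSpace X] [GeodesicHyperbolicSpace X] :
    Setoid {x : ℕ → X // ConvergesAtInfinity x} where
  r x y := ∀ o : X, Filter.Tendsto (fun n => gromovProduct o (x.1 n) (y.1 n))
    Filter.atTop Filter.atTop
  iseqv := by
    refine ⟨fun x o => ?_, fun {x y} h o => ?_, fun {x y z} h k o => ?_⟩
    · refine (x.2 o).comp (g := fun p : ℕ × ℕ => gromovProduct o (x.1 p.1) (x.1 p.2))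
        (f := fun n : ℕ => (n, n)) ?_
      rw [← Filter.prod_atTop_atTop_eq]
      exact Filter.tendsto_id.prodMk Filter.tendsto_id
    · refine (h o).congr fun n => ?_
      simp only [gromovProduct, dist_comm (x.1 n) (y.1 n)]
      ring
    · obtain ⟨δ, hδ⟩ := GeodesicHyperbolicSpace.hyperbolic (X := X)
      rw [Filter.tendsto_atTop]
      intro b
      filter_upwards [(Filter.tendsto_atTop.1 (h o)) (b + δ),
        (Filter.tendsto_atTop.1 (k o)) (b + δ)] with n h1 h2
      have h3 := hδ o (x.1 n) (y.1 n) (z.1 n)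
      have h4 := le_min h1 h2
      linarith

/-- The Gromov boundary `∂X`. -/
def GromovBoundary (X : Type v) [MetricSpace X] [GeodesicHyperbolicSpace X] : Type v :=
  Quotient (boundarySetoid X)

/-- The point of `∂X` to which a sequence convergent at infinity converges. -/
def GromovBoundary.mk {X : Type v} [MetricSpace X] [GeodesicHyperbolicSpace X]
    (x : ℕ → X) (hx : ConvergesAtInfinity x) : GromovBoundary X :=
  Quotient.mk (boundarySetoid X) ⟨x, hx⟩

theorem gromovProduct_isometryEquiv {X : Type v} [MetricSpace X] (φ : X ≃ᵢ X) (o x y : X) :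
    gromovProduct o (φ x) (φ y) = gromovProduct (φ.symm o) x y := by
  have h : ∀ z : X, dist (φ z) o = dist z (φ.symm o) := fun z => by
    rw [← φ.dist_eq z (φ.symm o), φ.apply_symm_apply]
  simp only [gromovProduct, h, φ.dist_eq]

theorem ConvergesAtInfinity.map {X : Type v} [MetricSpace X] {x : ℕ → X}
    (hx : ConvergesAtInfinity x) (φ : X ≃ᵢ X) : ConvergesAtInfinity (fun n => φ (x n)) := by
  intro o
  simp only [gromovProduct_isometryEquiv]
  exact hx (φ.symm o)

/-- The map of `∂X` induced by an isometry of `X`: the class of `(x_n)` goes to the class of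
`(φ x_n)`. -/
def GromovBoundary.map {X : Type v} [MetricSpace X] [GeodesicHyperbolicSpace X]
    (φ : X ≃ᵢ X) : GromovBoundary X → GromovBoundary X :=
  Quotient.map' (s₁ := boundarySetoid X) (s₂ := boundarySetoid X)
    (fun x => ⟨fun n => φ (x.1 n), x.2.map φ⟩) (by
      intro x y h o
      simp only [gromovProduct_isometryEquiv]
      exact h (φ.symm o))

/-! ### Isometric actions -/

/-- The limit set `Λ(G) ⊆ ∂X` of an isometric action `ρ`: the points of `∂X` that are limits of
sequences in an orbit (it is the same for all orbits). -/
def limitSet {G : Type u} [Group G] {X : Type v} [MetricSpace X] [GeodesicHyperbolicSpace X]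
    (ρ : G →* (X ≃ᵢ X)) : Set (GromovBoundary X) :=
  {ξ | ∃ (x : X) (g : ℕ → G) (h : ConvergesAtInfinity (fun n => ρ (g n) x)),
    ξ = GromovBoundary.mk (fun n => ρ (g n) x) h}

/-- The action is of general type: the limit set is infinite and no point of `∂X` is fixed by the
whole group. -/
def IsGeneralType {G : Type u} [Group G] {X : Type v} [MetricSpace X]
    [GeodesicHyperbolicSpace X] (ρ : G →* (X ≃ᵢ X)) : Prop :=
  (limitSet ρ).Infinite ∧
    ¬ ∃ ξ : GromovBoundary X, ∀ g : G, GromovBoundary.map (ρ g) ξ = ξ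

/-- Quasi-isometric embeddings of metric spaces. -/
def IsQuasiIsometricEmbedding {A : Type u} {B : Type v} [MetricSpace A] [MetricSpace B]
    (f : A → B) : Prop :=
  ∃ K C : ℝ, 1 ≤ K ∧ 0 ≤ C ∧ ∀ a b : A,
    dist a b / K - C ≤ dist (f a) (f b) ∧ dist (f a) (f b) ≤ K * dist a b + C

/-- An isometry `φ` of `X` is loxodromic if the orbit map `ℤ → X`, `n ↦ φⁿ x`, is a
quasi-isometric embedding for some (equivalently, every) `x`. -/
def IsLoxodromic {X : Type v} [MetricSpace X] (φ : X ≃ᵢ X) : Prop :=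
  ∃ x : X, IsQuasiIsometricEmbedding (fun n : ℤ => (φ ^ n) x)

/-! ### The properties (NGT), (NL) and hereditary (NL) -/

/-- (NGT): no isometric action on a hyperbolic space is of general type. -/
def NGT (G : Type u) [Group G] : Prop :=
  ∀ (X : Type v) [MetricSpace X] [GeodesicHyperbolicSpace X] (ρ : G →* (X ≃ᵢ X)),
    ¬ IsGeneralType ρ

/-- (NL): no isometric action on a hyperbolic space has a loxodromic element. -/
def NL (G : Type u) [Group G] : Prop :=
  ∀ (X : Type v) [MetricSpace X] [GeodesicHyperbolicSpace X] (ρ : G →* (X ≃ᵢ X)) (g : G),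
    ¬ IsLoxodromic (ρ g)

/-- Hereditary (NL): every finite-index subgroup has (NL). -/
def HereditaryNL (G : Type u) [Group G] : Prop :=
  ∀ H : Subgroup G, H.FiniteIndex → NL.{u, v} H

/-! ### Amenability, and the group `ℝ ⋊ ℤ/2` -/

/-- A (discrete) group is amenable if it carries a finitely additive probability measure, defined
on all subsets, that is invariant under left translations. -/
def IsAmenableGroup (G : Type u) [Group G] : Prop :=
  ∃ μ : Set G → ℝ, (∀ s, 0 ≤ μ s) ∧ μ Set.univ = 1 ∧
    (∀ s t, Disjoint s t → μ (s ∪ t) = μ s + μ t) ∧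
    ∀ (g : G) (s : Set G), μ ((fun x => g * x) '' s) = μ s

/-- The action of `ℤ/2` on `ℝ` whose nontrivial element is `x ↦ -x`, in multiplicative notation. -/
noncomputable def signAction : Multiplicative (ZMod 2) →* MulAut (Multiplicative ℝ) where
  toFun a := if a = 1 then 1 else MulEquiv.inv (Multiplicative ℝ)
  map_one' := if_pos rfl
  map_mul' a b := by
    have key : ∀ a b : Multiplicative (ZMod 2),
        (a * b = 1) ↔ (a = 1 ↔ b = 1) := by decide
    have hinv : MulEquiv.inv (Multiplicative ℝ) * MulEquiv.inv (Multiplicative ℝ) = 1 := by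
      ext x
      simp
    by_cases ha : a = 1 <;> by_cases hb : b = 1 <;> simp [key, ha, hb, hinv]

/-- The group `ℝ ⋊ ℤ/2`, that is, the isometry group of the line. -/
abbrev RealSemidirectZ2 : Type :=
  Multiplicative ℝ ⋊[signAction] Multiplicative (ZMod 2)

/-- Every homomorphism `H → ℝ ⋊ ℤ/2` has image of order at most `2`. -/
def SmallImages (H : Type u) [Group H] : Prop :=
  ∀ ψ : H →* RealSemidirectZ2, (Set.range ψ).encard ≤ 2

/-- `H` surjects onto `ℤ` or onto the infinite dihedral group `D_∞` (which is
`DihedralGroup 0`). -/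
def SurjectsOntoZOrDInfty (H : Type u) [Group H] : Prop :=
  (∃ f : H →* Multiplicative ℤ, Function.Surjective f) ∨
    (∃ f : H →* DihedralGroup 0, Function.Surjective f)

/-! An action with two limit points, or with a loxodromic element, has an isometry with a coarse
axis, whose positive and negative powers drive a point `x` to two distinct boundary points
(`IsAxial`, with the local criterion `isAxial_of_dist`). Push an invariant mean of `G` forward to
`X` along an orbit. What avoids neighbourhoods of both endpoints is wandering under the axial
element, hence null. So the boundary points charged by the mean form a nonempty `G`-invariant subset
of the two endpoints, and `G` fixes an endpoint or preserves the pair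
(`IsAmenableGroup.fixes_endpoint_or_preserves_pair`). In the latter case the limit set lies in the
pair; either way the action is not of general type.

For (NL), the Busemann function at such an endpoint is a quasi-cocycle, twisted by the sign that
records swaps. Averaging against the mean gives a true cocycle at bounded distance, still nonzero on
the axial element. Real cocycles are homomorphisms to `ℝ ⋊ ℤ/2`, that is, actions on the line, and a
nonzero value at an element of trivial sign is a nontrivial translation (`HasTranslation`), which is
loxodromic. Having no translation means having images of order at most 2 (`smallImages_iff`). If `G`
is finitely generated, the values span a free abelian group of finite rank, so the cocycle can be
made integral and normalised to a surjection onto `ℤ` or `D_∞`.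

The abelian and nilpotent cases use no mean: elements of finite order are never loxodromic,
injectivity of `ℝ` detects elements of infinite order in abelian groups, and a nilpotent group with
torsion abelianization is torsion. -/

open Filter Topology

/-! ### Elementary properties of the Gromov product -/

section GromovProduct

variable {X : Type v} [MetricSpace X]

/-- Gromov's four-point inequality with constant `δ`. -/
def FourPoint (X : Type v) [MetricSpace X] (δ : ℝ) : Prop :=
  ∀ o x y z : X, min (gromovProduct o x y) (gromovProduct o y z) - δ ≤ gromovProduct o x z

theorem FourPoint.nonneg [Nonempty X] {δ : ℝ} (hδ : FourPoint X δ) : 0 ≤ δ := by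
  obtain ⟨x⟩ := ‹Nonempty X›
  have := hδ x x x x
  simp [gromovProduct] at this
  exact this

theorem FourPoint.le_or_le {δ : ℝ} (hδ : FourPoint X δ) {o x z : X} {r : ℝ}
    (h : gromovProduct o x z ≤ r) (y : X) :
    gromovProduct o x y ≤ r + δ ∨ gromovProduct o y z ≤ r + δ := by
  have := hδ o x y z
  rw [← min_le_iff]
  linarith

theorem FourPoint.le_of_le_of_le {δ : ℝ} (hδ : FourPoint X δ) {o x y z : X} {r : ℝ}
    (h₁ : r + δ ≤ gromovProduct o x y) (h₂ : r + δ ≤ gromovProduct o y z) :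
    r ≤ gromovProduct o x z := by
  have := hδ o x y z
  have := le_min h₁ h₂
  linarith

theorem gromovProduct_comm (o x y : X) : gromovProduct o x y = gromovProduct o y x := by
  simp only [gromovProduct, dist_comm x y]
  ring

theorem gromovProduct_nonneg (o x y : X) : 0 ≤ gromovProduct o x y := by
  have := dist_triangle_right x y o
  rw [gromovProduct]
  linarith

theorem gromovProduct_self (o x : X) : gromovProduct o x x = dist o x := by
  rw [gromovProduct, dist_self, dist_comm x o]
  ring

theorem gromovProduct_add (o x y : X) :
    gromovProduct o x y + gromovProduct x o y = dist o x := by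
  simp only [gromovProduct, dist_comm x o, dist_comm y x, dist_comm y o]
  ring

theorem gromovProduct_le_dist (o x y : X) : gromovProduct o x y ≤ dist o x := by
  linarith [gromovProduct_add o x y, gromovProduct_nonneg x o y]

theorem gromovProduct_sub_le (o o' x y : X) :
    gromovProduct o x y - dist o o' ≤ gromovProduct o' x y := by
  have h₁ := dist_triangle_right x o o'
  have h₂ := dist_triangle_right y o o'
  have h₃ := dist_triangle x o' o
  have h₄ := dist_triangle y o' o
  rw [dist_comm o' o] at h₃ h₄
  simp only [gromovProduct]
  linarith

theorem gromovProduct_sub_dist_le (o x y y' : X) :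
    gromovProduct o x y - dist y y' ≤ gromovProduct o x y' := by
  have h₁ := dist_triangle_right y o y'
  have h₂ := dist_triangle x y y'
  have h₃ := dist_triangle y y' o
  simp only [gromovProduct]
  linarith

theorem gromovProduct_map (φ : X ≃ᵢ X) (o x y : X) :
    gromovProduct (φ o) (φ x) (φ y) = gromovProduct o x y := by
  simp only [gromovProduct, φ.dist_eq]

theorem gromovProduct_map_left (φ : X ≃ᵢ X) (o x y : X) :
    gromovProduct (φ o) x y = gromovProduct o (φ⁻¹ x) (φ⁻¹ y) := by
  rw [← gromovProduct_map φ o]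
  simp only [IsometryEquiv.apply_inv_self]

end GromovProduct

/-! ### Isometries with a coarse axis -/

section Axial

variable {X : Type v} [MetricSpace X]

/-- The orbit of `x` under the powers of `φ` behaves like an axis: points on opposite sides of `x`
have Gromov product at most `C`, and the orbit goes to infinity. -/
structure IsAxial (φ : X ≃ᵢ X) (x : X) (C : ℝ) : Prop where
  product_le : ∀ k n : ℕ, gromovProduct x ((φ⁻¹ ^ k) x) ((φ ^ n) x) ≤ C
  tendsto : Tendsto (fun n : ℕ => dist x ((φ ^ n) x)) atTop atTop

theorem dist_inv_pow_apply (φ : X ≃ᵢ X) (x : X) (n : ℕ) :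
    dist x ((φ⁻¹ ^ n) x) = dist x ((φ ^ n) x) := by
  rw [← (φ ^ n).dist_eq x, inv_pow, IsometryEquiv.apply_inv_self, dist_comm]

theorem IsAxial.inv {φ : X ≃ᵢ X} {x : X} {C : ℝ} (h : IsAxial φ x C) : IsAxial φ⁻¹ x C where
  product_le k n := by
    rw [inv_inv, gromovProduct_comm]
    exact h.product_le n k
  tendsto := by
    simp only [dist_inv_pow_apply]
    exact h.tendsto

/-- This is `gromovProduct_add` with the second base point `φ ^ n x` translated back to `x`. A small
product across `x` thus means a large product on one side of it. -/
theorem gromovProduct_pow_apply_add {φ : X ≃ᵢ X} {x : X} (n k : ℕ) :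
    gromovProduct x ((φ ^ n) x) ((φ ^ (n + k)) x) +
      gromovProduct x ((φ⁻¹ ^ n) x) ((φ ^ k) x) = dist x ((φ ^ n) x) := by
  rw [← gromovProduct_add x ((φ ^ n) x) ((φ ^ (n + k)) x), gromovProduct_map_left (φ ^ n), pow_add,
    IsometryEquiv.mul_apply, IsometryEquiv.inv_apply_self, inv_pow]

theorem IsAxial.le_gromovProduct {φ : X ≃ᵢ X} {x : X} {C : ℝ} (h : IsAxial φ x C) {n m : ℕ}
    (hnm : n ≤ m) : dist x ((φ ^ n) x) - C ≤ gromovProduct x ((φ ^ n) x) ((φ ^ m) x) := by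
  obtain ⟨k, rfl⟩ := Nat.exists_eq_add_of_le hnm
  linarith [gromovProduct_pow_apply_add (φ := φ) (x := x) n k, h.product_le n k]

/-- With `α = (φ⁻¹ x | φ x)_x`, the hypothesis says `d(x, φ x) > 2α + 2δ`. In the inductive step the
bad alternative of the four-point inequality, combined with the bound for `n`, would give `d(x, φ x)
≤ 2α + 2δ`. -/
theorem gromovProduct_inv_pow_le {δ : ℝ} (hδ : FourPoint X δ) {φ : X ≃ᵢ X} {x : X}
    (h : dist x (φ x) + 2 * δ < dist x (φ (φ x))) (n : ℕ) :
    gromovProduct x (φ⁻¹ x) ((φ ^ (n + 1)) x) ≤ gromovProduct x (φ⁻¹ x) (φ x) + δ := by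
  have : Nonempty X := ⟨x⟩
  have h0 := hδ.nonneg
  have h2 : dist (φ⁻¹ x) (φ x) = dist x (φ (φ x)) := by
    rw [← φ.dist_eq, IsometryEquiv.apply_inv_self]
  have h1 : dist (φ⁻¹ x) x = dist x (φ x) := by
    rw [← φ.dist_eq, IsometryEquiv.apply_inv_self]
  have hα : 2 * gromovProduct x (φ⁻¹ x) (φ x) = 2 * dist x (φ x) - dist x (φ (φ x)) := by
    rw [gromovProduct, h1, h2, dist_comm (φ x) x]
    ring
  induction n with
  | zero => simpa using h0
  | succ n ih =>
    rcases hδ.le_or_le (le_refl (gromovProduct x (φ⁻¹ x) (φ x))) ((φ ^ (n + 1 + 1)) x) with h' | h'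
    · exact h'
    · have := gromovProduct_pow_apply_add (φ := φ) (x := x) 1 (n + 1)
      rw [gromovProduct_comm x ((φ ^ 1) x), add_comm 1 (n + 1), pow_one, pow_one] at this
      linarith

/-- Local-to-global principle: little backtracking in one step forbids backtracking along the whole
orbit. The third `δ` pays for one more four-point inequality, which passes from `φ⁻¹ x` to a general
negative power. -/
theorem isAxial_of_dist {δ : ℝ} (hδ : FourPoint X δ) {φ : X ≃ᵢ X} {x : X}
    (h : dist x (φ x) + 3 * δ < dist x (φ (φ x))) : ∃ C, IsAxial φ x C := by
  have : Nonempty X := ⟨x⟩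
  have h0 := hδ.nonneg
  have h2 : dist (φ⁻¹ x) (φ x) = dist x (φ (φ x)) := by
    rw [← φ.dist_eq, IsometryEquiv.apply_inv_self]
  have h1 : dist (φ⁻¹ x) x = dist x (φ x) := by
    rw [← φ.dist_eq, IsometryEquiv.apply_inv_self]
  have h1' : dist x (φ⁻¹ x) = dist x (φ x) := by rw [dist_comm, h1]
  have h2' : dist x (φ⁻¹ (φ⁻¹ x)) = dist x (φ (φ x)) := by
    rw [← h2, ← φ.dist_eq, IsometryEquiv.apply_inv_self, dist_comm]
  set α := gromovProduct x (φ⁻¹ x) (φ x) with hαdef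
  have hα : 2 * α = 2 * dist x (φ x) - dist x (φ (φ x)) := by
    rw [hαdef, gromovProduct, h1, h2, dist_comm (φ x) x]
    ring
  have hα0 : 0 ≤ α := gromovProduct_nonneg _ _ _
  have hpos (n : ℕ) : gromovProduct x (φ⁻¹ x) ((φ ^ (n + 1)) x) ≤ α + δ :=
    gromovProduct_inv_pow_le hδ (by linarith) n
  have hneg (n : ℕ) : gromovProduct x (φ x) ((φ⁻¹ ^ (n + 1)) x) ≤ α + δ := by
    have := gromovProduct_inv_pow_le hδ (φ := φ⁻¹) (x := x) (by rw [h1', h2']; linarith) n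
    rwa [inv_inv, gromovProduct_comm x (φ x) (φ⁻¹ x)] at this
  refine ⟨α + 2 * δ, fun k n => ?_, ?_⟩
  · rcases k with _ | k
    · simpa [gromovProduct, dist_comm] using by linarith
    rcases n with _ | n
    · simpa [gromovProduct, dist_comm] using by linarith
    rcases hδ.le_or_le (hpos n) ((φ⁻¹ ^ (k + 1)) x) with h' | h'
    · rcases k with _ | k
      · have := hpos n
        rw [zero_add, pow_one]
        linarith
      have := gromovProduct_pow_apply_add (φ := φ⁻¹) (x := x) 1 (k + 1)
      rw [add_comm 1 (k + 1), pow_one, inv_inv, pow_one, h1'] at this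
      linarith [hneg k]
    · linarith
  -- Each step gains at least `η > 0`, so the distance grows linearly.
  · have hstep (n : ℕ) : dist x ((φ ^ (n + 1)) x) + (dist x (φ x) - 2 * (α + δ)) ≤
        dist x ((φ ^ (n + 2)) x) := by
      have := hpos n
      rw [gromovProduct, h1, dist_comm _ x, ← φ.dist_eq (φ⁻¹ x), IsometryEquiv.apply_inv_self,
        ← IsometryEquiv.mul_apply φ, ← pow_succ'] at this
      linarith
    set η := dist x (φ x) - 2 * (α + δ) with hη
    have hη0 : 0 < η := by linarith
    have hlin (n : ℕ) : n * η ≤ dist x ((φ ^ (n + 1)) x) := by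
      induction n with
      | zero => simp
      | succ n ih =>
        have := hstep n
        push_cast
        linarith
    rw [← tendsto_add_atTop_iff_nat 1]
    exact tendsto_atTop_mono hlin (tendsto_natCast_atTop_atTop.atTop_mul_const hη0)

/-- If no power met the criterion, doubling the exponent would add at most `3δ` to the displacement.
Growth along powers of 2 would be logarithmic, against the linear lower bound. -/
theorem IsLoxodromic.exists_pow_isAxial {δ : ℝ} (hδ : FourPoint X δ) {φ : X ≃ᵢ X}
    (h : IsLoxodromic φ) : ∃ (N : ℕ) (x : X) (C : ℝ), IsAxial (φ ^ N) x C := by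
  obtain ⟨x, K, C, hK, hC, hqi⟩ := h
  have : Nonempty X := ⟨x⟩
  have h0 := hδ.nonneg
  by_contra! hno
  have hle (N : ℕ) : dist x ((φ ^ (2 * N)) x) ≤ dist x ((φ ^ N) x) + 3 * δ := by
    by_contra! hlt
    rw [two_mul, pow_add, IsometryEquiv.mul_apply] at hlt
    obtain ⟨C', hC'⟩ := isAxial_of_dist hδ hlt
    exact hno N x C' hC'
  have hup (j : ℕ) : dist x ((φ ^ 2 ^ j) x) ≤ dist x (φ x) + j * (3 * δ) := by
    induction j with
    | zero => simp
    | succ j ih =>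
      have := hle (2 ^ j)
      rw [← pow_succ'] at this
      push_cast
      linarith
  have hlow (n : ℕ) : n / K - C ≤ dist x ((φ ^ n) x) := by
    simpa [Int.dist_eq'] using (hqi 0 n).1
  -- Chosen so that `(j + 1) * A` exceeds `d(x, φ x) + C + 6jδ`. The exponent `2 ^ (2 * j)` is a
  -- product of two factors at least `j + 1`, one of which absorbs `K * A`.
  set A := dist x (φ x) + C + 6 * δ + 1 with hA
  have hA0 : 0 < A := by positivity
  obtain ⟨j, hj⟩ := exists_nat_gt (K * A)
  have h1 : ((2 : ℝ) ^ (2 * j)) / K - C ≤ dist x (φ x) + (2 * j) * (3 * δ) := by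
    have := (hlow (2 ^ (2 * j))).trans (hup (2 * j))
    push_cast at this
    exact this
  have h2 : ((j : ℝ) + 1) ≤ 2 ^ j := by
    exact_mod_cast Nat.succ_le_of_lt (Nat.lt_two_pow_self (n := j))
  have hj0 : (0 : ℝ) ≤ j := j.cast_nonneg
  have h3 : ((j : ℝ) + 1) * A ≤ 2 ^ (2 * j) / K := by
    rw [le_div_iff₀ (by linarith), mul_comm 2 j, pow_mul, sq]
    calc ((j : ℝ) + 1) * A * K ≤ (j + 1) * (j + 1) := by
          rw [mul_assoc]
          gcongr
          linarith
      _ ≤ 2 ^ j * 2 ^ j := by gcongr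
  have hd := dist_nonneg (x := x) (y := φ x)
  nlinarith [mul_nonneg hj0 hd, mul_nonneg hj0 hC, mul_nonneg hj0 h0]

end Axial

/-! ### Convergence at infinity and the boundary -/

section Boundary

variable {X : Type v} [MetricSpace X]

theorem exists_fourPoint (X : Type v) [MetricSpace X] [GeodesicHyperbolicSpace X] :
    ∃ δ, FourPoint X δ :=
  GeodesicHyperbolicSpace.hyperbolic

theorem tendsto_gromovProduct_of_base {ι : Type*} {l : Filter ι} {z w : ι → X} {o : X}
    (h : Tendsto (fun i => gromovProduct o (z i) (w i)) l atTop) (o' : X) :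
    Tendsto (fun i => gromovProduct o' (z i) (w i)) l atTop :=
  tendsto_atTop_mono (fun i => gromovProduct_sub_le o o' (z i) (w i))
    (tendsto_atTop_add_const_right _ (-dist o o') h)

theorem ConvergesAtInfinity.exists_le {z : ℕ → X} (hz : ConvergesAtInfinity z) (o : X) (R : ℝ) :
    ∃ N, ∀ i ≥ N, ∀ j ≥ N, R ≤ gromovProduct o (z i) (z j) := by
  obtain ⟨⟨a, b⟩, hab⟩ := (tendsto_atTop.1 (hz o) R).exists_forall_of_atTop
  exact ⟨max a b, fun i hi j hj => hab (i, j) ⟨(le_max_left a b).trans hi,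
    (le_max_right a b).trans hj⟩⟩

theorem convergesAtInfinity_of_exists_le {z : ℕ → X} (o : X)
    (h : ∀ R : ℝ, ∃ N, ∀ i ≥ N, ∀ j ≥ N, R ≤ gromovProduct o (z i) (z j)) :
    ConvergesAtInfinity z := by
  intro o'
  refine tendsto_gromovProduct_of_base (o := o) ?_ o'
  refine tendsto_atTop.2 fun R => ?_
  obtain ⟨N, hN⟩ := h R
  filter_upwards [eventually_ge_atTop (N, N)] with p hp
  exact hN p.1 hp.1 p.2 hp.2

theorem ConvergesAtInfinity.tendsto_dist {z : ℕ → X} (hz : ConvergesAtInfinity z) (o : X) :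
    Tendsto (fun n => dist o (z n)) atTop atTop := by
  refine tendsto_atTop.2 fun R => ?_
  obtain ⟨N, hN⟩ := hz.exists_le o R
  filter_upwards [eventually_ge_atTop N] with n hn
  rw [← gromovProduct_self]
  exact hN n hn n hn

theorem IsAxial.convergesAtInfinity {φ : X ≃ᵢ X} {x : X} {C : ℝ} (h : IsAxial φ x C) :
    ConvergesAtInfinity (fun n => (φ ^ n) x) := by
  refine convergesAtInfinity_of_exists_le x fun R => ?_
  obtain ⟨N, hN⟩ := (tendsto_atTop.1 h.tendsto (R + C)).exists_forall_of_atTop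
  refine ⟨N, fun i hi j hj => ?_⟩
  rcases le_total i j with hij | hij
  · linarith [h.le_gromovProduct hij, hN i hi]
  · rw [gromovProduct_comm]
    linarith [h.le_gromovProduct hij, hN j hj]

theorem eventually_gromovProduct_le {δ : ℝ} (hδ : FourPoint X δ) {x : X} {z w z' w' : ℕ → X}
    {C : ℝ} (hz : Tendsto (fun n => gromovProduct x (z n) (z' n)) atTop atTop)
    (hw : Tendsto (fun n => gromovProduct x (w n) (w' n)) atTop atTop)
    (h : ∀ n, gromovProduct x (z n) (w n) ≤ C) :
    ∀ᶠ n in atTop, gromovProduct x (z' n) (w' n) ≤ C + 2 * δ := by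
  filter_upwards [tendsto_atTop.1 hz (C + δ + 1), tendsto_atTop.1 hw (C + 2 * δ + 1)]
    with n hzn hwn
  rcases hδ.le_or_le (h n) (z' n) with h' | h'
  · linarith
  · rcases hδ.le_or_le h' (w' n) with h'' | h''
    · linarith
    · rw [gromovProduct_comm] at h''
      linarith

variable [GeodesicHyperbolicSpace X]

theorem GromovBoundary.mk_eq_mk_iff (o : X) {z w : ℕ → X} {hz : ConvergesAtInfinity z}
    {hw : ConvergesAtInfinity w} :
    GromovBoundary.mk z hz = GromovBoundary.mk w hw ↔
      Tendsto (fun n => gromovProduct o (z n) (w n)) atTop atTop := by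
  have : GromovBoundary.mk z hz = GromovBoundary.mk w hw ↔
      ∀ o : X, Tendsto (fun n => gromovProduct o (z n) (w n)) atTop atTop :=
    Quotient.eq (r := boundarySetoid X)
  rw [this]
  exact ⟨fun h => h o, fun h => tendsto_gromovProduct_of_base h⟩

theorem GromovBoundary.map_mk (φ : X ≃ᵢ X) (z : ℕ → X) (hz : ConvergesAtInfinity z) :
    GromovBoundary.map φ (GromovBoundary.mk z hz) =
      GromovBoundary.mk (fun n => φ (z n)) (hz.map φ) :=
  rfl

theorem GromovBoundary.exists_mk (ξ : GromovBoundary X) :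
    ∃ z hz, ξ = GromovBoundary.mk z hz := by
  obtain ⟨⟨z, hz⟩, rfl⟩ := Quotient.exists_rep ξ
  exact ⟨z, hz, rfl⟩

theorem GromovBoundary.map_mul (φ ψ : X ≃ᵢ X) (ξ : GromovBoundary X) :
    GromovBoundary.map (φ * ψ) ξ = GromovBoundary.map φ (GromovBoundary.map ψ ξ) := by
  obtain ⟨z, hz, rfl⟩ := ξ.exists_mk
  rfl

theorem GromovBoundary.map_one (ξ : GromovBoundary X) :
    GromovBoundary.map (1 : X ≃ᵢ X) ξ = ξ := by
  obtain ⟨z, hz, rfl⟩ := ξ.exists_mk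
  rfl

theorem GromovBoundary.map_inv_map (φ : X ≃ᵢ X) (ξ : GromovBoundary X) :
    GromovBoundary.map φ⁻¹ (GromovBoundary.map φ ξ) = ξ := by
  rw [← map_mul, inv_mul_cancel, map_one]

theorem GromovBoundary.map_injective (φ : X ≃ᵢ X) :
    Function.Injective (GromovBoundary.map φ) :=
  Function.LeftInverse.injective (GromovBoundary.map_inv_map φ)

/-- Inequivalence bounds the product only along infinitely many diagonal pairs. Convergence of both
sequences spreads the bound to all late pairs, at a cost of `2δ`. -/
theorem GromovBoundary.exists_le_of_ne (x : X) {z w : ℕ → X} {hz : ConvergesAtInfinity z}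
    {hw : ConvergesAtInfinity w} (h : GromovBoundary.mk z hz ≠ GromovBoundary.mk w hw) :
    ∃ C N, ∀ i ≥ N, ∀ j ≥ N, gromovProduct x (z i) (w j) ≤ C := by
  obtain ⟨δ, hδ⟩ := exists_fourPoint X
  rw [Ne, GromovBoundary.mk_eq_mk_iff x, tendsto_atTop] at h
  push Not at h
  obtain ⟨C, hC⟩ := h
  obtain ⟨N₁, hN₁⟩ := hz.exists_le x (C + 2 * δ)
  obtain ⟨N₂, hN₂⟩ := hw.exists_le x (C + 2 * δ)
  refine ⟨C + 2 * δ, max N₁ N₂, fun i hi j hj => ?_⟩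
  obtain ⟨n, hn, hnC⟩ := frequently_atTop.1 hC (max N₁ N₂)
  have hx : Nonempty X := ⟨x⟩
  have h0 := hδ.nonneg
  by_contra! hlt
  have h₁ := hN₁ n (le_of_max_le_left hn) i (le_of_max_le_left hi)
  have h₂ := hN₂ j (le_of_max_le_right hj) n (le_of_max_le_right hn)
  have h₃ : C + δ ≤ gromovProduct x (z n) (w j) :=
    hδ.le_of_le_of_le (y := z i) (by linarith) (by linarith)
  have h₄ : C ≤ gromovProduct x (z n) (w n) :=
    hδ.le_of_le_of_le (y := w j) (by linarith) (by linarith)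
  linarith

/-- The endpoint in `∂X` of the positive powers of `φ`. -/
def IsAxial.endpoint {φ : X ≃ᵢ X} {x : X} {C : ℝ} (h : IsAxial φ x C) : GromovBoundary X :=
  GromovBoundary.mk _ h.convergesAtInfinity

theorem IsAxial.endpoint_inv_ne {φ : X ≃ᵢ X} {x : X} {C : ℝ} (h : IsAxial φ x C) :
    h.inv.endpoint ≠ h.endpoint := by
  rw [IsAxial.endpoint, IsAxial.endpoint, Ne, GromovBoundary.mk_eq_mk_iff x, tendsto_atTop]
  intro h'
  obtain ⟨n, hn⟩ := (h' (C + 1)).exists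
  linarith [h.product_le n n]

end Boundary

/-! ### Two limit points produce an axial element -/

section LimitSet

variable {G : Type u} [Group G] {X : Type v} [MetricSpace X]

theorem dist_apply_apply_eq (φ : X ≃ᵢ X) (x : X) :
    dist x (φ (φ x)) = 2 * dist x (φ x) - 2 * gromovProduct x (φ x) (φ⁻¹ x) := by
  have h₁ : dist (φ⁻¹ x) x = dist x (φ x) := by
    rw [← φ.dist_eq, IsometryEquiv.apply_inv_self]
  have h₂ : dist (φ x) (φ⁻¹ x) = dist x (φ (φ x)) := by
    rw [← φ.dist_eq, IsometryEquiv.apply_inv_self, dist_comm]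
  rw [gromovProduct, h₁, h₂, dist_comm (φ x) x]
  ring

/-- If `a` fails the criterion, `a⁻¹ x` lies in nearly the same direction as `a x`; likewise for
`b`. As the directions of `a x` and `b x` diverge, `a * b` moves `x` far towards `a x` and its
inverse moves `x` towards `b⁻¹ x`, so `a * b` does not backtrack. -/
theorem exists_isAxial_of_gromovProduct_le {δ : ℝ} (hδ : FourPoint X δ) {a b : X ≃ᵢ X} {x : X}
    {C : ℝ} (hC : gromovProduct x (a x) (b x) ≤ C) (ha : 4 * C + 20 * δ + 1 ≤ dist x (a x))
    (hb : 4 * C + 20 * δ + 1 ≤ dist x (b x)) :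
    (∃ C', IsAxial a x C') ∨ (∃ C', IsAxial b x C') ∨ (∃ C', IsAxial (a * b) x C') := by
  have : Nonempty X := ⟨x⟩
  have h0 := hδ.nonneg
  have hC0 := (gromovProduct_nonneg x (a x) (b x)).trans hC
  by_cases hax : dist x (a x) + 3 * δ < dist x (a (a x))
  · exact Or.inl (isAxial_of_dist hδ hax)
  by_cases hbx : dist x (b x) + 3 * δ < dist x (b (b x))
  · exact Or.inr (Or.inl (isAxial_of_dist hδ hbx))
  refine Or.inr (Or.inr (isAxial_of_dist hδ ?_))
  have ha2 := dist_apply_apply_eq a x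
  have hb2 := dist_apply_apply_eq b x
  have h₁ : gromovProduct x (a⁻¹ x) (b x) ≤ C + δ := by
    rcases hδ.le_or_le hC (a⁻¹ x) with h | h
    · linarith
    · exact h
  have h₂ : gromovProduct x (a x) (b⁻¹ x) ≤ C + δ := by
    rcases hδ.le_or_le hC (b⁻¹ x) with h | h
    · exact h
    · rw [gromovProduct_comm] at h
      linarith
  have ha1 : dist (a⁻¹ x) x = dist x (a x) := by
    rw [← a.dist_eq, IsometryEquiv.apply_inv_self]
  have hb1 : dist (b⁻¹ x) x = dist x (b x) := by
    rw [← b.dist_eq, IsometryEquiv.apply_inv_self]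
  set c := a * b with hc
  have hcx : dist x (c x) = dist (a⁻¹ x) (b x) := by
    rw [hc, IsometryEquiv.mul_apply, ← a.dist_eq (a⁻¹ x), IsometryEquiv.apply_inv_self]
  have hc1 : dist (c⁻¹ x) x = dist x (c x) := by
    rw [← c.dist_eq, IsometryEquiv.apply_inv_self]
  have hlen : dist x (c x) = dist x (a x) + dist x (b x) - 2 * gromovProduct x (a⁻¹ x) (b x) := by
    rw [gromovProduct, ha1, hcx, dist_comm (b x) x]
    ring
  have h₃ : gromovProduct x (c x) (a x) = (dist x (c x) + dist x (a x) - dist x (b x)) / 2 := by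
    have : dist (c x) (a x) = dist x (b x) := by
      rw [hc, IsometryEquiv.mul_apply, a.dist_eq, dist_comm]
    rw [gromovProduct, this, dist_comm (c x), dist_comm (a x)]
  have h₄ : gromovProduct x (b⁻¹ x) (c⁻¹ x) =
      (dist x (b x) + dist x (c x) - dist x (a x)) / 2 := by
    have : dist (b⁻¹ x) (c⁻¹ x) = dist x (a x) := by
      rw [hc, mul_inv_rev, IsometryEquiv.mul_apply, b⁻¹.dist_eq, dist_comm, ha1]
    rw [gromovProduct, this, hb1, hc1]
  have h₅ : gromovProduct x (c x) (b⁻¹ x) ≤ C + 2 * δ := by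
    rw [gromovProduct_comm] at h₂
    rcases hδ.le_or_le h₂ (c x) with h | h
    · rw [gromovProduct_comm]
      linarith
    · linarith
  have h₆ : gromovProduct x (c x) (c⁻¹ x) ≤ C + 3 * δ := by
    rw [gromovProduct_comm] at h₅
    rcases hδ.le_or_le h₅ (c⁻¹ x) with h | h
    · linarith
    · rw [gromovProduct_comm]
      linarith
  rw [dist_apply_apply_eq c x]
  linarith

variable [GeodesicHyperbolicSpace X] {ρ : G →* (X ≃ᵢ X)}

theorem exists_orbit_of_mem_limitSet {ξ : GromovBoundary X} (hξ : ξ ∈ limitSet ρ) (x : X) :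
    ∃ (g : ℕ → G) (h : ConvergesAtInfinity (fun n => ρ (g n) x)),
      ξ = GromovBoundary.mk (fun n => ρ (g n) x) h := by
  obtain ⟨y, g, h, rfl⟩ := hξ
  have hle (m n : ℕ) : gromovProduct y (ρ (g m) y) (ρ (g n) y) - dist y x ≤
      gromovProduct y (ρ (g m) y) (ρ (g n) x) := by
    rw [← (ρ (g n)).dist_eq y x]
    exact gromovProduct_sub_dist_le _ _ _ _
  have hle' (m n : ℕ) : gromovProduct y (ρ (g m) y) (ρ (g n) x) - dist y x ≤
      gromovProduct y (ρ (g m) x) (ρ (g n) x) := by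
    rw [← (ρ (g m)).dist_eq y x, gromovProduct_comm, gromovProduct_comm y (ρ (g m) x)]
    exact gromovProduct_sub_dist_le _ _ _ _
  have hx : ConvergesAtInfinity (fun n => ρ (g n) x) := by
    refine convergesAtInfinity_of_exists_le y fun R => ?_
    obtain ⟨N, hN⟩ := h.exists_le y (R + 2 * dist y x)
    exact ⟨N, fun i hi j hj => by linarith [hN i hi j hj, hle i j, hle' i j]⟩
  refine ⟨g, hx, (GromovBoundary.mk_eq_mk_iff y).2 (tendsto_atTop.2 fun R => ?_)⟩
  obtain ⟨N, hN⟩ := h.exists_le y (R + dist y x)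
  filter_upwards [eventually_ge_atTop N] with n hn
  linarith [hN n hn n hn, hle n n]

theorem exists_isAxial_of_limitSet_nontrivial (h : (limitSet ρ).Nontrivial) :
    ∃ (k : G) (x : X) (C : ℝ), IsAxial (ρ k) x C := by
  obtain ⟨δ, hδ⟩ := exists_fourPoint X
  obtain ⟨x⟩ := GeodesicHyperbolicSpace.nonempty (X := X)
  obtain ⟨ξ, hξ, η, hη, hne⟩ := h
  obtain ⟨a, ha, rfl⟩ := exists_orbit_of_mem_limitSet hξ x
  obtain ⟨b, hb, rfl⟩ := exists_orbit_of_mem_limitSet hη x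
  obtain ⟨C, N, hC⟩ := GromovBoundary.exists_le_of_ne x hne
  obtain ⟨n, han, hbn, hn⟩ := ((tendsto_atTop.1 (ha.tendsto_dist x) (4 * C + 20 * δ + 1)).and
    ((tendsto_atTop.1 (hb.tendsto_dist x) (4 * C + 20 * δ + 1)).and
      (eventually_ge_atTop N))).exists
  rcases exists_isAxial_of_gromovProduct_le hδ (hC n hn n hn) han hbn with
    ⟨C', h⟩ | ⟨C', h⟩ | ⟨C', h⟩
  · exact ⟨_, x, C', h⟩
  · exact ⟨_, x, C', h⟩
  · rw [← map_mul] at h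
    exact ⟨_, x, C', h⟩

end LimitSet

/-! ### Finitely additive means -/

section Mean

/-- A finitely additive probability measure on all subsets of `α`. -/
structure IsMean {α : Type*} (m : Set α → ℝ) : Prop where
  nonneg : ∀ s, 0 ≤ m s
  univ : m Set.univ = 1
  union : ∀ s t, Disjoint s t → m (s ∪ t) = m s + m t

namespace IsMean

variable {α β : Type*} {m : Set α → ℝ}

theorem mono (hm : IsMean m) {s t : Set α} (h : s ⊆ t) : m s ≤ m t := by
  have := hm.union s (t \ s) Set.disjoint_sdiff_right
  rw [Set.union_sdiff_cancel h] at this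
  linarith [hm.nonneg (t \ s)]

theorem le_one (hm : IsMean m) (s : Set α) : m s ≤ 1 :=
  hm.univ ▸ hm.mono (Set.subset_univ s)

theorem empty (hm : IsMean m) : m ∅ = 0 := by
  have := hm.union ∅ ∅ (Set.disjoint_empty _)
  rw [Set.union_empty] at this
  linarith

theorem union_le (hm : IsMean m) (s t : Set α) : m (s ∪ t) ≤ m s + m t := by
  rw [← Set.union_sdiff_self, hm.union _ _ Set.disjoint_sdiff_right]
  linarith [hm.mono (Set.sdiff_subset (s := t) (t := s))]

theorem compl (hm : IsMean m) (s : Set α) : m sᶜ = 1 - m s := by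
  have := hm.union s sᶜ disjoint_compl_right
  rw [Set.union_compl_self, hm.univ] at this
  linarith

theorem comap (hm : IsMean m) (f : α → β) : IsMean fun s => m (f ⁻¹' s) where
  nonneg _ := hm.nonneg _
  univ := hm.univ
  union _ _ h := hm.union _ _ (h.preimage f)

theorem eq_zero_of_pairwise_disjoint (hm : IsMean m) {s : ℕ → Set α} {c : ℝ}
    (hs : ∀ n, m (s n) = c) (hd : Pairwise (Function.onFun Disjoint s)) : c = 0 := by
  have hsum (n : ℕ) : m (⋃ i ∈ Finset.range n, s i) = n * c := by
    induction n with
    | zero => simp [hm.empty]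
    | succ n ih =>
      rw [Finset.range_add_one, Finset.set_biUnion_insert, hm.union, ih, hs]
      · push_cast
        ring
      · rw [Set.disjoint_iUnion₂_right]
        exact fun i hi => hd (Finset.mem_range.1 hi).ne'
  have hc : 0 ≤ c := hs 0 ▸ hm.nonneg _
  by_contra hne
  obtain ⟨n, hn⟩ := exists_nat_gt (1 / c)
  have := hm.le_one (⋃ i ∈ Finset.range n, s i)
  rw [hsum] at this
  rw [div_lt_iff₀ (lt_of_le_of_ne hc (Ne.symm hne))] at hn
  linarith

end IsMean

theorem IsAmenableGroup.exists_mean {G : Type u} [Group G] (hG : IsAmenableGroup G) :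
    ∃ m : Set G → ℝ, IsMean m ∧ ∀ (g : G) (s : Set G), m ((fun x => g * x) ⁻¹' s) = m s := by
  obtain ⟨m, h₁, h₂, h₃, h₄⟩ := hG
  refine ⟨m, ⟨h₁, h₂, h₃⟩, fun g s => ?_⟩
  rw [← h₄ g ((fun x => g * x) ⁻¹' s), Set.image_preimage_eq _ (Group.mulLeft_bijective g).2]

theorem IsMean.isAmenableGroup {G : Type u} [Group G] {m : Set G → ℝ} (hm : IsMean m)
    (h : ∀ (g : G) (s : Set G), m ((fun x => g * x) ⁻¹' s) = m s) : IsAmenableGroup G := by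
  refine ⟨m, hm.nonneg, hm.univ, hm.union, fun g s => ?_⟩
  rw [← h g, Set.preimage_image_eq _ (mul_right_injective g)]

theorem IsAmenableGroup.exists_invariant_mean {G : Type u} [Group G] (hG : IsAmenableGroup G)
    {X : Type v} [MetricSpace X] [Nonempty X] (ρ : G →* (X ≃ᵢ X)) :
    ∃ m : Set X → ℝ, IsMean m ∧ ∀ (g : G) (s : Set X), m (ρ g '' s) = m s := by
  obtain ⟨m, hm, hinv⟩ := hG.exists_mean
  obtain ⟨x⟩ := ‹Nonempty X›
  -- The orbit map is equivariant, so the pushed-forward mean is invariant.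
  refine ⟨_, hm.comap fun k => ρ k x, fun g s => ?_⟩
  rw [← hinv g]
  congr 1
  ext k
  simp

end Mean

/-! ### The mean concentrates near the endpoints -/

section Shadow

variable {X : Type v} [MetricSpace X]

/-- The neighbourhood in `X` of the limit of `z` given by the points whose Gromov product with
that limit exceeds `R`. -/
def shadow (x : X) (z : ℕ → X) (R : ℝ) : Set X :=
  {y | ∀ᶠ n in atTop, R < gromovProduct x y (z n)}

theorem shadow_anti (x : X) (z : ℕ → X) {R R' : ℝ} (h : R ≤ R') :
    shadow x z R' ⊆ shadow x z R :=
  fun _ hy => hy.mono fun _ hn => h.trans_lt hn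

theorem image_shadow_subset (φ : X ≃ᵢ X) (x : X) (z : ℕ → X) (R : ℝ) :
    φ '' shadow x z R ⊆ shadow x (fun n => φ (z n)) (R - dist x (φ x)) := by
  rintro _ ⟨y, hy, rfl⟩
  refine hy.mono fun n hn => ?_
  have := gromovProduct_sub_le (φ x) x (φ y) (φ (z n))
  rw [gromovProduct_map, dist_comm] at this
  linarith

/-- Off the positive shadow, `y` has product at most `R + δ` with `φ ^ k x` seen from `x`, once `φ ^
k x` is far away. The other hypothesis, translated by `φ ^ k`, bounds the product of `y` and `x`
seen from `φ ^ k x`. The two products add up to `d(x, φ ^ k x)`. -/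
theorem IsAxial.dist_le_of_notMem_shadow {δ : ℝ} (hδ : FourPoint X δ) {φ : X ≃ᵢ X} {x y : X}
    {C R : ℝ} (h : IsAxial φ x C) (k : ℕ) (hy : y ∉ shadow x (fun n => (φ ^ n) x) R)
    (hy' : (φ ^ k)⁻¹ y ∉ shadow x (fun n => (φ⁻¹ ^ n) x) R) :
    dist x ((φ ^ k) x) ≤ max (R + δ + C) (2 * R + 2 * δ) := by
  have key {ψ : X ≃ᵢ X} (hψ : IsAxial ψ x C) {w : X}
      (hw : w ∉ shadow x (fun n => (ψ ^ n) x) R) (hk : R + δ + C < dist x ((ψ ^ k) x)) :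
      gromovProduct x w ((ψ ^ k) x) ≤ R + δ := by
    have hw' : ¬ ∀ᶠ n in atTop, R < gromovProduct x w ((ψ ^ n) x) := hw
    obtain ⟨n, hn, hnR⟩ := frequently_atTop.1 (not_eventually.1 hw') k
    rcases hδ.le_or_le (not_lt.1 hnR) ((ψ ^ k) x) with h' | h'
    · exact h'
    · linarith [hψ.le_gromovProduct hn]
  by_contra! hlt
  obtain ⟨h₁, h₂⟩ := max_lt_iff.1 hlt
  have h₃ := key h hy h₁
  have h₄ := key h.inv hy' (by rwa [dist_inv_pow_apply])
  rw [inv_pow, ← gromovProduct_map_left] at h₄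
  rw [gromovProduct_comm] at h₃ h₄
  linarith [gromovProduct_add x ((φ ^ k) x) y,
    gromovProduct_comm ((φ ^ k) x) x y]

/-- The complement `B` is disjoint from `φ ^ k B` for all `k ≥ N`, so its translates by powers of `φ
^ (N + 1)` are pairwise disjoint sets of equal mass, which must be 0. -/
theorem IsAxial.mean_shadow_union {δ : ℝ} (hδ : FourPoint X δ) {φ : X ≃ᵢ X} {x : X} {C : ℝ}
    (h : IsAxial φ x C) {m : Set X → ℝ} (hm : IsMean m)
    (hinv : ∀ (n : ℕ) (s : Set X), m ((φ ^ n) '' s) = m s) (R : ℝ) :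
    m (shadow x (fun n => (φ ^ n) x) R ∪ shadow x (fun n => (φ⁻¹ ^ n) x) R) = 1 := by
  set B := (shadow x (fun n => (φ ^ n) x) R ∪ shadow x (fun n => (φ⁻¹ ^ n) x) R)ᶜ with hB
  suffices m B = 0 by
    rw [hB, hm.compl] at this
    linarith
  obtain ⟨N, hN⟩ := (h.tendsto.eventually_gt_atTop
    (max (R + δ + C) (2 * R + 2 * δ))).exists_forall_of_atTop
  have hdisj (k : ℕ) (hk : N ≤ k) : Disjoint B ((φ ^ k) '' B) := by
    rw [Set.disjoint_left]
    rintro y hy ⟨w, hw, rfl⟩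
    refine (hN k hk).not_ge (h.dist_le_of_notMem_shadow hδ k (fun h' => hy (Or.inl h')) fun h' => ?_)
    rw [IsometryEquiv.inv_apply_self] at h'
    exact hw (Or.inr h')
  refine hm.eq_zero_of_pairwise_disjoint (s := fun n => (φ ^ (n * (N + 1))) '' B)
    (fun n => hinv _ _) ?_
  rw [(symm_disjoint.comap _).pairwise_on]
  intro i j hij
  obtain ⟨k, rfl⟩ := Nat.exists_eq_add_of_lt hij
  have : φ ^ ((i + k + 1) * (N + 1)) = φ ^ (i * (N + 1)) * φ ^ ((k + 1) * (N + 1)) := by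
    rw [← pow_add]
    ring_nf
  simp only [Function.onFun, this]
  rw [IsometryEquiv.coe_mul, Set.image_comp, Set.disjoint_image_iff (φ ^ (i * (N + 1))).injective]
  exact hdisj _ (by nlinarith)

variable [GeodesicHyperbolicSpace X]

theorem exists_disjoint_shadow (x : X) {z w : ℕ → X} {hz : ConvergesAtInfinity z}
    {hw : ConvergesAtInfinity w} (h : GromovBoundary.mk z hz ≠ GromovBoundary.mk w hw) :
    ∃ R₀, ∀ R ≥ R₀, Disjoint (shadow x z R) (shadow x w R) := by
  obtain ⟨δ, hδ⟩ := exists_fourPoint X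
  obtain ⟨C, N, hC⟩ := GromovBoundary.exists_le_of_ne x h
  refine ⟨C + δ, fun R hR => Set.disjoint_left.2 fun y hy hy' => ?_⟩
  obtain ⟨n, hn, hyz, hyw⟩ := ((eventually_ge_atTop N).and (hy.and hy')).exists
  rcases hδ.le_or_le (hC n hn n hn) y with h' | h'
  · rw [gromovProduct_comm] at h'
    linarith
  · linarith

/-- The mean `m` gives a positive weight to the boundary point `ξ`. -/
def IsCharged (m : Set X → ℝ) (x : X) (ξ : GromovBoundary X) : Prop :=
  ∃ (z : ℕ → X) (hz : ConvergesAtInfinity z), ξ = GromovBoundary.mk z hz ∧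
    ∃ c > 0, ∀ R, c ≤ m (shadow x z R)

/-- Applying `φ` changes the level of a shadow by at most `d(x, φ x)`, which is harmless because the
lower bound `c` holds at every level. -/
theorem IsCharged.map {m : Set X → ℝ} (hm : IsMean m) {x : X} {ξ : GromovBoundary X}
    (h : IsCharged m x ξ) {φ : X ≃ᵢ X} (hφ : ∀ s, m (φ '' s) = m s) :
    IsCharged m x (GromovBoundary.map φ ξ) := by
  obtain ⟨z, hz, rfl, c, hc, hR⟩ := h
  refine ⟨_, hz.map φ, GromovBoundary.map_mk φ z hz, c, hc, fun R => ?_⟩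
  have := hm.mono (image_shadow_subset φ x z (R + dist x (φ x)))
  rw [hφ, add_sub_cancel_right] at this
  exact (hR _).trans this

variable {φ : X ≃ᵢ X} {x : X} {C : ℝ} {m : Set X → ℝ}

/-- A third charged point would have a shadow of mass at least `c` disjoint from a set of full mass.
-/
theorem IsAxial.eq_or_eq_of_isCharged (h : IsAxial φ x C) (hm : IsMean m)
    (hinv : ∀ (n : ℕ) (s : Set X), m ((φ ^ n) '' s) = m s) {ξ : GromovBoundary X}
    (hξ : IsCharged m x ξ) : ξ = h.endpoint ∨ ξ = h.inv.endpoint := by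
  obtain ⟨δ, hδ⟩ := exists_fourPoint X
  obtain ⟨z, hz, rfl, c, hc, hR⟩ := hξ
  by_contra! hne
  obtain ⟨R₁, hR₁⟩ := exists_disjoint_shadow x hne.1
  obtain ⟨R₂, hR₂⟩ := exists_disjoint_shadow x hne.2
  have h₁ := hm.union _ _ (Set.disjoint_union_right.2
    ⟨hR₁ _ (le_max_left R₁ R₂), hR₂ _ (le_max_right R₁ R₂)⟩)
  rw [h.mean_shadow_union hδ hm hinv] at h₁
  linarith [hR (max R₁ R₂), hm.le_one (shadow x z (max R₁ R₂) ∪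
    (shadow x (fun n => (φ ^ n) x) (max R₁ R₂) ∪ shadow x (fun n => (φ⁻¹ ^ n) x) (max R₁ R₂)))]

theorem IsAxial.isCharged_endpoint (h : IsAxial φ x C) (hm : IsMean m)
    (hinv : ∀ (n : ℕ) (s : Set X), m ((φ ^ n) '' s) = m s) :
    IsCharged m x h.endpoint ∨ IsCharged m x h.inv.endpoint := by
  obtain ⟨δ, hδ⟩ := exists_fourPoint X
  by_contra! hno
  have key {ψ : X ≃ᵢ X} (hψ : IsAxial ψ x C) (hch : ¬ IsCharged m x hψ.endpoint) :
      ∃ R, m (shadow x (fun n => (ψ ^ n) x) R) < 1 / 3 := by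
    by_contra! hR
    -- Any constant up to `1 / 2` would do: two shadows below it cannot have a union of mass 1.
    exact hch ⟨_, _, rfl, 1 / 3, by norm_num, hR⟩
  obtain ⟨R₁, hR₁⟩ := key h hno.1
  obtain ⟨R₂, hR₂⟩ := key h.inv hno.2
  have h₁ := h.mean_shadow_union hδ hm hinv (max R₁ R₂)
  have h₂ := hm.union_le (shadow x (fun n => (φ ^ n) x) (max R₁ R₂))
    (shadow x (fun n => (φ⁻¹ ^ n) x) (max R₁ R₂))
  have h₃ := hm.mono (shadow_anti x (fun n => (φ ^ n) x) (le_max_left R₁ R₂))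
  have h₄ := hm.mono (shadow_anti x (fun n => (φ⁻¹ ^ n) x) (le_max_right R₁ R₂))
  linarith

end Shadow

/-! ### Amenable groups have (NGT) -/

section AmenableAction

variable {G : Type u} [Group G] {X : Type v} [MetricSpace X] [GeodesicHyperbolicSpace X]
  {ρ : G →* (X ≃ᵢ X)}

/-- An amenable group acting with an axial element fixes one of the two endpoints of that element
or preserves the pair that they form. -/
theorem IsAmenableGroup.fixes_endpoint_or_preserves_pair (hG : IsAmenableGroup G) {k : G} {x : X}
    {C : ℝ} (h : IsAxial (ρ k) x C) :
    (∀ g, GromovBoundary.map (ρ g) h.endpoint = h.endpoint) ∨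
    (∀ g, GromovBoundary.map (ρ g) h.inv.endpoint = h.inv.endpoint) ∨
    ∀ g, (GromovBoundary.map (ρ g) h.endpoint = h.endpoint ∧
        GromovBoundary.map (ρ g) h.inv.endpoint = h.inv.endpoint) ∨
      (GromovBoundary.map (ρ g) h.endpoint = h.inv.endpoint ∧
        GromovBoundary.map (ρ g) h.inv.endpoint = h.endpoint) := by
  have : Nonempty X := ⟨x⟩
  obtain ⟨m, hm, hinv⟩ := hG.exists_invariant_mean ρ
  have hpow (n : ℕ) (s : Set X) : m ((ρ k ^ n) '' s) = m s := by rw [← map_pow, hinv]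
  have hmem (g : G) {ξ : GromovBoundary X} (hξ : IsCharged m x ξ) :=
    h.eq_or_eq_of_isCharged hm hpow (hξ.map hm (hinv g))
  by_cases hP : IsCharged m x h.endpoint
  · by_cases hM : IsCharged m x h.inv.endpoint
    · refine Or.inr (Or.inr fun g => ?_)
      have hinj := (GromovBoundary.map_injective (ρ g)).ne h.endpoint_inv_ne
      rcases hmem g hP with h₁ | h₁ <;> rcases hmem g hM with h₂ | h₂
      · exact absurd (h₂.trans h₁.symm) hinj
      · exact Or.inl ⟨h₁, h₂⟩
      · exact Or.inr ⟨h₁, h₂⟩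
      · exact absurd (h₂.trans h₁.symm) hinj
    · refine Or.inl fun g => (hmem g hP).resolve_right fun h' => hM ?_
      rw [← h']
      exact hP.map hm (hinv g)
  · have hM := (h.isCharged_endpoint hm hpow).resolve_left hP
    refine Or.inr (Or.inl fun g => (hmem g hM).resolve_left fun h' => hP ?_)
    rw [← h']
    exact hM.map hm (hinv g)

/-- Two sequences going to boundary points fixed or swapped by `g` have bounded Gromov product
also with respect to the base point `g x`. -/
theorem eventually_gromovProduct_apply_le {δ : ℝ} (hδ : FourPoint X δ) {φ : X ≃ᵢ X} {x : X}
    {z w : ℕ → X} {hz : ConvergesAtInfinity z} {hw : ConvergesAtInfinity w} {C : ℝ}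
    (hC : ∀ n, gromovProduct x (z n) (w n) ≤ C)
    (hφ : (GromovBoundary.map φ (.mk z hz) = .mk z hz ∧
        GromovBoundary.map φ (.mk w hw) = .mk w hw) ∨
      (GromovBoundary.map φ (.mk z hz) = .mk w hw ∧
        GromovBoundary.map φ (.mk w hw) = .mk z hz)) :
    ∀ᶠ n in atTop, gromovProduct (φ x) (z n) (w n) ≤ C + 2 * δ := by
  have hC' (n : ℕ) : gromovProduct (φ x) (φ (z n)) (φ (w n)) ≤ C := by
    rw [gromovProduct_map]
    exact hC n
  simp only [GromovBoundary.map_mk, GromovBoundary.mk_eq_mk_iff (φ x)] at hφ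
  rcases hφ with ⟨h₁, h₂⟩ | ⟨h₁, h₂⟩
  · exact eventually_gromovProduct_le hδ h₁ h₂ hC'
  · filter_upwards [eventually_gromovProduct_le hδ h₁ h₂ hC'] with n hn
    rwa [gromovProduct_comm]

/-- An orbit point `g x` stays near the axis, as the endpoints also have bounded product seen from
`g x`. For `z`, `w` near the endpoints, `d(x, gx) + (z|w)_x = (gx|z)_x + (gx|w)_x + (z|w)_{gx}`, so
an orbit sequence tending to a third point would be bounded. -/
theorem IsAxial.limitSet_subset {k : G} {x : X} {C : ℝ} (h : IsAxial (ρ k) x C)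
    (hpair : ∀ g, (GromovBoundary.map (ρ g) h.endpoint = h.endpoint ∧
        GromovBoundary.map (ρ g) h.inv.endpoint = h.inv.endpoint) ∨
      (GromovBoundary.map (ρ g) h.endpoint = h.inv.endpoint ∧
        GromovBoundary.map (ρ g) h.inv.endpoint = h.endpoint)) :
    limitSet ρ ⊆ {h.endpoint, h.inv.endpoint} := by
  obtain ⟨δ, hδ⟩ := exists_fourPoint X
  intro ξ hξ
  obtain ⟨g, hg, rfl⟩ := exists_orbit_of_mem_limitSet hξ x
  by_contra hne
  simp only [Set.mem_insert_iff, Set.mem_singleton_iff, not_or] at hne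
  obtain ⟨C₁, N₁, h₁⟩ := GromovBoundary.exists_le_of_ne x hne.1
  obtain ⟨C₂, N₂, h₂⟩ := GromovBoundary.exists_le_of_ne x hne.2
  obtain ⟨n, hn₁, hn₂, hn⟩ := ((eventually_ge_atTop N₁).and ((eventually_ge_atTop N₂).and
    ((hg.tendsto_dist x).eventually_gt_atTop (C₁ + C₂ + (C + 2 * δ))))).exists
  have hC (j : ℕ) : gromovProduct x ((ρ k ^ j) x) (((ρ k)⁻¹ ^ j) x) ≤ C := by
    rw [gromovProduct_comm]
    exact h.product_le j j
  obtain ⟨j, hj₁, hj₂, hj⟩ := ((eventually_ge_atTop N₁).and ((eventually_ge_atTop N₂).and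
    (eventually_gromovProduct_apply_le hδ hC (hpair (g n))))).exists
  have h₃ := h₁ n hn₁ j hj₁
  have h₄ := h₂ n hn₂ j hj₂
  have h₅ := gromovProduct_nonneg x ((ρ k ^ j) x) (((ρ k)⁻¹ ^ j) x)
  rw [dist_comm] at hn
  simp only [gromovProduct, dist_comm _ (ρ (g n) x)] at h₃ h₄ h₅ hj
  linarith

theorem IsAmenableGroup.ngt (hG : IsAmenableGroup G) : NGT.{u, v} G := by
  rintro X _ _ ρ ⟨hinf, hfix⟩
  obtain ⟨k, x, C, h⟩ := exists_isAxial_of_limitSet_nontrivial hinf.nontrivial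
  rcases hG.fixes_endpoint_or_preserves_pair h with hP | hM | hpair
  · exact hfix ⟨_, hP⟩
  · exact hfix ⟨_, hM⟩
  · exact hinf ((Set.toFinite _).subset (h.limitSet_subset hpair))

end AmenableAction

/-! ### Integrating finite-range functions against a mean -/

section Integral

variable {α : Type*} {m : Set α → ℝ}

/-- The integral of a function with finite range against a finitely additive measure. -/
noncomputable def meanIntegral (m : Set α → ℝ) (u : α → ℝ) : ℝ :=
  ∑ᶠ r, m (u ⁻¹' {r}) * r

theorem meanIntegral_comp {T : α → α} (hT : ∀ s, m (T ⁻¹' s) = m s) (u : α → ℝ) :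
    meanIntegral m (fun a => u (T a)) = meanIntegral m u :=
  finsum_congr fun r => by rw [← hT (u ⁻¹' {r})]; rfl

namespace IsMean

open MeasureTheory

/-- The measure `m` as a family of continuous linear maps, the form used by
`MeasureTheory.SimpleFunc.setToSimpleFunc`. -/
noncomputable def toCLM (m : Set α → ℝ) (s : Set α) : ℝ →L[ℝ] ℝ :=
  m s • ContinuousLinearMap.id ℝ ℝ

theorem finMeasAdditive (hm : IsMean m) :
    -- The zero measure makes every finiteness side condition trivial.
    FinMeasAdditive (0 : @Measure α ⊤) (toCLM m) := by
  intro s t _ _ _ _ hst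
  rw [toCLM, hm.union s t hst, add_smul]
  rfl

theorem meanIntegral_eq (hm : IsMean m) (u : @SimpleFunc α ⊤ ℝ) :
    meanIntegral m u = @SimpleFunc.setToSimpleFunc α ℝ ℝ _ _ _ _ ⊤ (toCLM m) u := by
  let _ : MeasurableSpace α := ⊤
  rw [meanIntegral, SimpleFunc.setToSimpleFunc]
  refine (finsum_eq_sum_of_support_subset _ fun r hr => ?_).trans (Finset.sum_congr rfl fun r _ => ?_)
  · by_contra hr'
    have : u ⁻¹' {r} = ∅ := by
      rw [Set.preimage_singleton_eq_empty]
      exact fun h => hr' (SimpleFunc.mem_range.2 h)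
    exact hr (by simp only [this, hm.empty, zero_mul])
  · simp [toCLM]

/-- A function with finite range as a simple function for the σ-algebra of all sets. -/
def simpleFunc (u : α → ℝ) (hu : (Set.range u).Finite) : @SimpleFunc α ⊤ ℝ :=
  @SimpleFunc.mk α ⊤ ℝ u (fun _ => trivial) hu

theorem meanIntegral_sub (hm : IsMean m) {u v : α → ℝ} (hu : (Set.range u).Finite)
    (hv : (Set.range v).Finite) :
    meanIntegral m (fun a => u a - v a) = meanIntegral m u - meanIntegral m v := by
  let _ : MeasurableSpace α := ⊤
  have := SimpleFunc.setToSimpleFunc_sub (toCLM m) hm.finMeasAdditive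
    (f := simpleFunc u hu) (g := simpleFunc v hv) integrable_zero_measure integrable_zero_measure
  rwa [← hm.meanIntegral_eq, ← hm.meanIntegral_eq, ← hm.meanIntegral_eq] at this

theorem meanIntegral_const (hm : IsMean m) (c : ℝ) : meanIntegral m (fun _ => c) = c := by
  let _ : MeasurableSpace α := ⊤
  have := SimpleFunc.setToSimpleFunc_const (m := ⊤) (toCLM m) (by simp [toCLM, hm.empty]) c
  rw [← hm.meanIntegral_eq] at this
  exact this.trans (by simp [toCLM, hm.univ])

theorem meanIntegral_add (hm : IsMean m) {u v : α → ℝ} (hu : (Set.range u).Finite)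
    (hv : (Set.range v).Finite) :
    meanIntegral m (fun a => u a + v a) = meanIntegral m u + meanIntegral m v := by
  let _ : MeasurableSpace α := ⊤
  have := SimpleFunc.setToSimpleFunc_add (toCLM m) hm.finMeasAdditive
    (f := simpleFunc u hu) (g := simpleFunc v hv) integrable_zero_measure integrable_zero_measure
  rwa [← hm.meanIntegral_eq, ← hm.meanIntegral_eq, ← hm.meanIntegral_eq] at this

theorem meanIntegral_nonneg (hm : IsMean m) {u : α → ℝ} (hu : ∀ a, 0 ≤ u a) :
    0 ≤ meanIntegral m u := by
  refine finsum_nonneg fun r => ?_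
  by_cases h : r ∈ Set.range u
  · obtain ⟨a, rfl⟩ := h
    exact mul_nonneg (hm.nonneg _) (hu a)
  · rw [Set.preimage_singleton_eq_empty.2 h, hm.empty, zero_mul]

theorem meanIntegral_mono (hm : IsMean m) {u v : α → ℝ} (hu : (Set.range u).Finite)
    (hv : (Set.range v).Finite) (h : ∀ a, u a ≤ v a) : meanIntegral m u ≤ meanIntegral m v := by
  have := hm.meanIntegral_nonneg (u := fun a => v a - u a) fun a => sub_nonneg.2 (h a)
  rw [hm.meanIntegral_sub hv hu] at this
  linarith

theorem abs_meanIntegral_sub_le (hm : IsMean m) {u : α → ℝ} (hu : (Set.range u).Finite)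
    {c D : ℝ} (h : ∀ a, |u a - c| ≤ D) : |meanIntegral m u - c| ≤ D := by
  have h₁ := hm.meanIntegral_mono (u := fun _ => c - D) Set.finite_range_const hu
    fun a => by linarith [(abs_le.1 (h a)).1]
  have h₂ := hm.meanIntegral_mono (v := fun _ => c + D) hu Set.finite_range_const
    fun a => by linarith [(abs_le.1 (h a)).2]
  rw [hm.meanIntegral_const] at h₁ h₂
  exact abs_le.2 ⟨by linarith, by linarith⟩

end IsMean

end Integral

/-! ### From quasi-cocycles to cocycles -/

section Cocycle

variable {G : Type u} [Group G] {A : Type*} [AddCommGroup A]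

/-- A `1`-cocycle of `G` with values in `A`, on which `G` acts by the signs given by `ε`. -/
def IsSignCocycle (ε : G →* Multiplicative (ZMod 2)) (f : G → A) : Prop :=
  ∀ a b, f (a * b) = f a + if ε a = 1 then f b else -f b

theorem finite_range_of_abs_le {α : Type*} {u : α → ℤ} {B : ℝ} (h : ∀ a, |(u a : ℝ)| ≤ B) :
    (Set.range fun a => (u a : ℝ)).Finite := by
  refine ((Set.finite_Icc (-⌈B⌉) ⌈B⌉).image (fun n : ℤ => (n : ℝ))).subset ?_
  rintro _ ⟨a, rfl⟩
  have h₁ := abs_le.1 (h a)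
  have h₂ := Int.le_ceil B
  refine ⟨u a, ⟨?_, ?_⟩, rfl⟩
  · exact_mod_cast (show (-⌈B⌉ : ℝ) ≤ u a by linarith)
  · exact_mod_cast (show (u a : ℝ) ≤ ⌈B⌉ by linarith)

/-- On an amenable group a quasi-cocycle is at bounded distance from a cocycle. -/
theorem IsAmenableGroup.exists_isSignCocycle (hG : IsAmenableGroup G)
    {ε : G →* Multiplicative (ZMod 2)} {q : G → ℝ} {D : ℝ}
    (hq : ∀ a b, |q (a * b) - (q a + if ε a = 1 then q b else -q b)| ≤ D) :
    ∃ f : G → ℝ, IsSignCocycle ε f ∧ ∃ D', ∀ g, |f g - q g| ≤ D' := by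
  obtain ⟨m, hm, hinv⟩ := hG.exists_mean
  -- Rounding gives the functions to be integrated finite range.
  set p : G → ℤ := fun g => ⌊q g⌋ with hp
  have hpq (g : G) : |(p g : ℝ) - q g| ≤ 1 :=
    abs_le.2 ⟨by linarith [Int.lt_floor_add_one (q g)], by linarith [Int.floor_le (q g)]⟩
  -- `U a b` is within `D + 2` of `q a`: `D` for the quasi-cocycle and 1 for each of two roundings.
  -- It satisfies `U (ac) b = U a (cb) ± U c b` with the sign of `a`, and integrating over `b`
  -- removes the shift by `c`.
  set U : G → G → ℤ := fun a b => p (a * b) - if ε a = 1 then p b else -p b with hU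
  have hUq (a b : G) : |(U a b : ℝ) - q a| ≤ D + 2 := by
    have h₁ := abs_le.1 (hq a b)
    have h₂ := abs_le.1 (hpq (a * b))
    have h₃ := abs_le.1 (hpq b)
    rw [abs_le, hU]
    dsimp only
    split_ifs at h₁ ⊢ <;> push_cast <;> constructor <;> linarith
  have hfin (a : G) : (Set.range fun b => (U a b : ℝ)).Finite := by
    refine finite_range_of_abs_le (B := |q a| + (D + 2)) fun b => ?_
    have := abs_add_le ((U a b : ℝ) - q a) (q a)
    rw [sub_add_cancel] at this
    linarith [hUq a b]
  have hfin' (a c : G) : (Set.range fun b => (U a (c * b) : ℝ)).Finite :=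
    (hfin a).subset (Set.range_comp_subset_range (fun b => c * b) fun b => (U a b : ℝ))
  refine ⟨fun a => meanIntegral m fun b => (U a b : ℝ), fun a c => ?_, D + 2, fun a =>
    hm.abs_meanIntegral_sub_le (hfin a) (hUq a)⟩
  have hshift := meanIntegral_comp (hinv c) fun b => (U a b : ℝ)
  dsimp only
  rw [← hshift]
  by_cases ha : ε a = 1
  · rw [if_pos ha, ← hm.meanIntegral_add (hfin' a c) (hfin c)]
    congr 1
    funext b
    simp only [hU, map_mul, ha, one_mul, if_true, mul_assoc]
    push_cast
    ring
  · rw [if_neg ha, ← sub_eq_add_neg, ← hm.meanIntegral_sub (hfin' a c) (hfin c)]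
    congr 1
    funext b
    have key : ∀ s t : Multiplicative (ZMod 2), s ≠ 1 → (s * t = 1 ↔ t ≠ 1) := by decide
    simp only [hU, map_mul, ha, key _ (ε c) ha, if_false, mul_assoc]
    by_cases hc : ε c = 1
    · simp only [hc, ne_eq, not_true_eq_false, if_true, if_false]
      push_cast
      ring
    · simp only [hc, ne_eq, not_false_eq_true, if_true, if_false]
      push_cast
      ring

end Cocycle

/-! ### Busemann quasi-cocycles -/

section Busemann

/-- Since `d(y, z) - d(x, z) = d(x, y) - 2 (y|z)_x`, it suffices that `(y|z)_x` and `(y|w)_x` differ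
by at most `δ`. Both are at most `d(x, y)`, so `(z|w)_x` is never the minimum. -/
theorem FourPoint.abs_busemann_sub_le {X : Type v} [MetricSpace X] {δ : ℝ} (hδ : FourPoint X δ)
    {x y z w : X} (h : dist x y ≤ gromovProduct x z w) :
    |(dist y z - dist x z) - (dist y w - dist x w)| ≤ 2 * δ := by
  have key {z w : X} (h : dist x y ≤ gromovProduct x z w) :
      gromovProduct x y z - δ ≤ gromovProduct x y w := by
    have h₁ := hδ x y z w
    rwa [min_eq_left ((gromovProduct_le_dist x y z).trans h)] at h₁
  have h₁ := key h
  have h₂ := key (gromovProduct_comm x z w ▸ h)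
  simp only [gromovProduct, dist_comm _ x] at h₁ h₂
  exact abs_le.2 ⟨by linarith, by linarith⟩

variable {G : Type u} [Group G] {X : Type v} [MetricSpace X] [GeodesicHyperbolicSpace X]
  {ρ : G →* (X ≃ᵢ X)}

/-- If `G` acts on the pair `P`, `M` either fixing `P` or swapping `P` and `M`, the swapping is
recorded by a homomorphism to `ℤ/2`. -/
theorem exists_sign {P M : GromovBoundary X} (hne : M ≠ P)
    (hpair : ∀ g, GromovBoundary.map (ρ g) P = P ∨
      (GromovBoundary.map (ρ g) P = M ∧ GromovBoundary.map (ρ g) M = P)) :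
    ∃ ε : G →* Multiplicative (ZMod 2), ∀ g, ε g = 1 ↔ GromovBoundary.map (ρ g) P = P := by
  classical
  have hmul (a b : G) : GromovBoundary.map (ρ (a * b)) P = P ↔
      (GromovBoundary.map (ρ a) P = P ↔ GromovBoundary.map (ρ b) P = P) := by
    rw [map_mul, GromovBoundary.map_mul]
    by_cases hb : GromovBoundary.map (ρ b) P = P
    · rw [hb]
      tauto
    · rw [((hpair b).resolve_left hb).1]
      refine ⟨fun h => ?_, fun h => ?_⟩
      · have : ¬ GromovBoundary.map (ρ a) P = P := fun h' =>
          hne (GromovBoundary.map_injective _ (h.trans h'.symm))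
        tauto
      · exact ((hpair a).resolve_left (by tauto)).2
  refine ⟨⟨⟨fun g => if GromovBoundary.map (ρ g) P = P then 1 else Multiplicative.ofAdd 1, ?_⟩, ?_⟩,
    fun g => ?_⟩
  · rw [map_one, GromovBoundary.map_one, if_pos rfl]
  · intro a b
    have hab := hmul a b
    rw [map_mul] at hab
    have h2 : (Multiplicative.ofAdd (1 : ZMod 2)) * Multiplicative.ofAdd 1 = 1 := by decide
    by_cases ha : GromovBoundary.map (ρ a) P = P <;>
      by_cases hb : GromovBoundary.map (ρ b) P = P <;> simp [hab, ha, hb, h2]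
  · have h1 : Multiplicative.ofAdd (1 : ZMod 2) ≠ 1 := by decide
    by_cases hg : GromovBoundary.map (ρ g) P = P <;> simp [hg]

/-- The Busemann quasi-cocycle at a boundary point `z` that is fixed, or swapped with `w`. -/
theorem exists_busemann_quasiCocycle {δ : ℝ} (hδ : FourPoint X δ) {x : X} {z w : ℕ → X}
    {hz : ConvergesAtInfinity z} {hw : ConvergesAtInfinity w} {C : ℝ}
    (hC : ∀ n, gromovProduct x (z n) (w n) ≤ C) {ε : G →* Multiplicative (ZMod 2)}
    (hε : ∀ g, ε g = 1 ↔ GromovBoundary.map (ρ g) (.mk z hz) = .mk z hz)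
    (hpair : ∀ g, GromovBoundary.map (ρ g) (.mk z hz) = .mk z hz ∨
      (GromovBoundary.map (ρ g) (.mk z hz) = .mk w hw ∧
        GromovBoundary.map (ρ g) (.mk w hw) = .mk z hz)) :
    ∃ q : G → ℝ,
      (∀ g, ∀ᶠ n in atTop, |dist (ρ g x) (z n) - dist x (z n) - q g| ≤ 2 * δ) ∧
      ∃ D, ∀ a b, |q (a * b) - (q a + if ε a = 1 then q b else -q b)| ≤ D := by
  have : Nonempty X := ⟨x⟩
  have h0 := hδ.nonneg
  have hC0 : 0 ≤ C := (gromovProduct_nonneg _ _ _).trans (hC 0)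
  have hex (y : X) : ∃ b : ℝ, ∀ᶠ n in atTop, |dist y (z n) - dist x (z n) - b| ≤ 2 * δ := by
    obtain ⟨N, hN⟩ := hz.exists_le x (dist x y)
    refine ⟨dist y (z N) - dist x (z N), ?_⟩
    filter_upwards [eventually_ge_atTop N] with n hn
    exact hδ.abs_busemann_sub_le (hN n hn N le_rfl)
  choose b hb using hex
  -- The worst case is a swap: four Busemann errors of `2δ`, and `2 (C + 2δ)` for exchanging the two
  -- ends.
  refine ⟨fun g => b (ρ g x), fun g => hb (ρ g x), 2 * C + 12 * δ, fun a c => ?_⟩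
  have hac (n : ℕ) : dist (ρ (a * c) x) (z n) = dist (ρ c x) (ρ a⁻¹ (z n)) := by
    rw [map_mul, map_inv, IsometryEquiv.mul_apply, ← (ρ a).dist_eq (ρ c x),
      IsometryEquiv.apply_inv_self]
  have ha (n : ℕ) : dist (ρ a x) (z n) = dist x (ρ a⁻¹ (z n)) := by
    rw [map_inv, ← (ρ a).dist_eq x, IsometryEquiv.apply_inv_self]
  by_cases hεa : ε a = 1
  · have hfix : GromovBoundary.map (ρ a⁻¹) (.mk z hz) = .mk z hz := by
      rw [← hε, map_inv, hεa, inv_one]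
    rw [GromovBoundary.map_mk, GromovBoundary.mk_eq_mk_iff x] at hfix
    obtain ⟨n, h₁, h₂, h₃, h₄⟩ := ((hb (ρ (a * c) x)).and ((hb (ρ a x)).and ((hb (ρ c x)).and
      (tendsto_atTop.1 hfix (dist x (ρ c x)))))).exists
    have h₅ := hδ.abs_busemann_sub_le h₄
    rw [hac] at h₁
    rw [ha] at h₂
    rw [if_pos hεa]
    rw [abs_le] at *
    constructor <;> linarith
  · have hswap : GromovBoundary.map (ρ a⁻¹) (.mk z hz) = .mk w hw :=
      ((hpair a⁻¹).resolve_left fun h => hεa (by rwa [← hε, map_inv, inv_eq_one] at h)).1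
    have hswap' := (hpair a).resolve_left fun h => hεa ((hε a).2 h)
    -- A priori an element fixing the first endpoint may move the second. Since `a` swaps them,
    -- comparing `a * c` with `a` shows that `c` preserves the pair.
    have hc : (GromovBoundary.map (ρ c) (.mk z hz) = .mk z hz ∧
          GromovBoundary.map (ρ c) (.mk w hw) = .mk w hw) ∨
        (GromovBoundary.map (ρ c) (.mk z hz) = .mk w hw ∧
          GromovBoundary.map (ρ c) (.mk w hw) = .mk z hz) := by
      refine (hpair c).imp_left fun h => ⟨h, ?_⟩
      have hac' : ¬ ε (a * c) = 1 := by rw [map_mul, (hε c).2 h, mul_one]; exact hεa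
      have := ((hpair (a * c)).resolve_left fun h => hac' ((hε _).2 h)).2
      rw [map_mul, GromovBoundary.map_mul, ← hswap'.2] at this
      exact GromovBoundary.map_injective _ this
    rw [GromovBoundary.map_mk, GromovBoundary.mk_eq_mk_iff x] at hswap
    obtain ⟨n, h₁, h₂, h₃, h₄, h₅⟩ := ((hb (ρ (a * c) x)).and ((hb (ρ a x)).and
      ((hb (ρ c x)).and ((tendsto_atTop.1 hswap (dist x (ρ c x))).and
        (eventually_gromovProduct_apply_le hδ hC hc))))).exists
    -- The Busemann function is now taken at the end `w`. The ones at `z` and `w` add up to `2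
    -- (z|w)_{cx} - 2 (z|w)_x`, which is bounded, so changing ends changes the sign.
    have h₆ := hδ.abs_busemann_sub_le h₄
    have h₇ := hC n
    have h₈ := gromovProduct_nonneg x (z n) (w n)
    have h₉ := gromovProduct_nonneg (ρ c x) (z n) (w n)
    rw [hac] at h₁
    rw [ha] at h₂
    rw [if_neg hεa]
    simp only [gromovProduct, dist_comm _ x, dist_comm _ (ρ c x)] at h₅ h₇ h₈ h₉
    rw [abs_le] at *
    constructor <;> linarith

theorem IsSignCocycle.apply_pow {A : Type*} [AddCommGroup A] {ε : G →* Multiplicative (ZMod 2)}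
    {f : G → A} (hf : IsSignCocycle ε f) {g : G} (hg : ε g = 1) (n : ℕ) : f (g ^ n) = n • f g := by
  induction n with
  | zero =>
    have := hf 1 1
    simpa using this
  | succ n ih => rw [pow_succ', hf, if_pos hg, ih, succ_nsmul']

/-- `φ` is kept apart from `ρ k` so that the inverse of an axial element can be used when only its
negative endpoint is fixed. -/
theorem IsAmenableGroup.exists_isSignCocycle_of_isAxial (hG : IsAmenableGroup G) {k : G}
    {φ : X ≃ᵢ X} (hk : ρ k = φ) {x : X} {C : ℝ} (h : IsAxial φ x C)
    (hpair : ∀ g, GromovBoundary.map (ρ g) h.endpoint = h.endpoint ∨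
      (GromovBoundary.map (ρ g) h.endpoint = h.inv.endpoint ∧
        GromovBoundary.map (ρ g) h.inv.endpoint = h.endpoint)) :
    ∃ (ε : G →* Multiplicative (ZMod 2)) (f : G → ℝ),
      IsSignCocycle ε f ∧ ∃ g, ε g = 1 ∧ f g ≠ 0 := by
  obtain ⟨δ, hδ⟩ := exists_fourPoint X
  obtain ⟨ε, hε⟩ := exists_sign h.endpoint_inv_ne hpair
  have hC (j : ℕ) : gromovProduct x ((φ ^ j) x) ((φ⁻¹ ^ j) x) ≤ C := by
    rw [gromovProduct_comm]
    exact h.product_le j j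
  obtain ⟨q, hq, D, hD⟩ := exists_busemann_quasiCocycle hδ hC hε hpair
  obtain ⟨f, hf, D', hD'⟩ := hG.exists_isSignCocycle hD
  have hεk : ε k = 1 := by
    rw [hε, hk, IsAxial.endpoint, GromovBoundary.map_mk, GromovBoundary.mk_eq_mk_iff x]
    refine tendsto_atTop_mono (fun n => ?_) (tendsto_atTop_add_const_right _ (-C) h.tendsto)
    have := h.le_gromovProduct n.le_succ
    rwa [pow_succ', IsometryEquiv.mul_apply, gromovProduct_comm] at this
  refine ⟨ε, f, hf, k, hεk, fun hfk => ?_⟩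
  -- If `f k = 0`, then `q (k ^ n)` is bounded in `n`. But moving `n` steps towards the endpoint
  -- lowers the Busemann function by at least `d(x, φ ^ n x) - 2C`.
  obtain ⟨n, hn⟩ := (h.tendsto.eventually_gt_atTop (2 * C + 2 * δ + D')).exists
  obtain ⟨j, hj, hnj⟩ := ((hq (k ^ n)).and (eventually_ge_atTop n)).exists
  have h₁ := hD' (k ^ n)
  rw [hf.apply_pow hεk, hfk, smul_zero] at h₁
  have h₂ := h.le_gromovProduct hnj
  rw [map_pow, hk] at hj
  simp only [gromovProduct, dist_comm _ x] at h₂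
  rw [abs_le] at *
  linarith

theorem IsAmenableGroup.exists_isSignCocycle_of_isLoxodromic (hG : IsAmenableGroup G) {k : G}
    (hk : IsLoxodromic (ρ k)) : ∃ (ε : G →* Multiplicative (ZMod 2)) (f : G → ℝ),
      IsSignCocycle ε f ∧ ∃ g, ε g = 1 ∧ f g ≠ 0 := by
  obtain ⟨δ, hδ⟩ := exists_fourPoint X
  obtain ⟨N, x, C, h⟩ := hk.exists_pow_isAxial hδ
  rw [← map_pow] at h
  rcases hG.fixes_endpoint_or_preserves_pair h with hP | hM | hpair
  · exact hG.exists_isSignCocycle_of_isAxial rfl h fun g => Or.inl (hP g)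
  · exact hG.exists_isSignCocycle_of_isAxial (map_inv ρ _) h.inv fun g => Or.inl (hM g)
  · exact hG.exists_isSignCocycle_of_isAxial rfl h fun g => (hpair g).imp_left And.left

end Busemann

/-! ### The real line as a hyperbolic space -/

section RealLine

instance : GeodesicHyperbolicSpace (ULift.{v} ℝ) where
  nonempty := inferInstance
  geodesic x y := by
    rcases le_total x.down y.down with h | h
    · refine ⟨fun t => ⟨x.down + t⟩, ?_, ?_, ?_⟩
      · simp
      · simp [ULift.dist_eq, Real.dist_eq, abs_of_nonpos (sub_nonpos.2 h)]
      · simp [ULift.dist_eq, Real.dist_eq]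
    · refine ⟨fun t => ⟨x.down - t⟩, ?_, ?_, ?_⟩
      · simp
      · simp [ULift.dist_eq, Real.dist_eq, abs_of_nonneg (sub_nonneg.2 h)]
      · intro s _ t _
        rw [ULift.dist_eq, Real.dist_eq, abs_sub_comm s t]
        congr 1
        ring
  hyperbolic := by
    refine ⟨0, fun o x y z => ?_⟩
    simp only [gromovProduct, ULift.dist_eq, Real.dist_eq, sub_zero, min_le_iff]
    generalize o.down = o, x.down = x, y.down = y, z.down = z
    grind

end RealLine

/-! ### Sign cocycles, actions on the line, and quotients `ℤ` and `D_∞` -/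

section SignCocycle

variable {G : Type u} [Group G] {A : Type*} [AddCommGroup A] {ε : G →* Multiplicative (ZMod 2)}

theorem mul_eq_one_iff_ne_of_ne {s t : Multiplicative (ZMod 2)} (hs : s ≠ 1) :
    s * t = 1 ↔ t ≠ 1 := by
  revert s t
  decide

namespace IsSignCocycle

variable {f : G → A}

theorem apply_one (hf : IsSignCocycle ε f) : f 1 = 0 := by
  have := hf 1 1
  simpa using this

theorem apply_inv (hf : IsSignCocycle ε f) (a : G) :
    f a⁻¹ = if ε a = 1 then -f a else f a := by
  have := hf a a⁻¹
  rw [mul_inv_cancel, hf.apply_one] at this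
  split_ifs at this ⊢
  · exact (neg_eq_of_add_eq_zero_right this.symm).symm
  · exact (add_neg_eq_zero.1 this.symm).symm

theorem comp_addMonoidHom {B : Type*} [AddCommGroup B] (hf : IsSignCocycle ε f) (l : A →+ B) :
    IsSignCocycle ε fun a => l (f a) := by
  intro a b
  dsimp only
  rw [hf a b]
  split_ifs <;> simp

theorem mem_closure (hf : IsSignCocycle ε f) {S : Set G} (hS : Subgroup.closure S = ⊤) (a : G) :
    f a ∈ AddSubgroup.closure (f '' S) := by
  have ha : a ∈ Subgroup.closure S := hS ▸ Subgroup.mem_top a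
  induction ha using Subgroup.closure_induction with
  | mem x hx => exact AddSubgroup.subset_closure ⟨x, hx, rfl⟩
  | one => rw [hf.apply_one]; exact zero_mem _
  | mul x y _ _ hx hy =>
    rw [hf x y]
    split_ifs
    · exact add_mem hx hy
    · exact add_mem hx (neg_mem hy)
  | inv x _ hx =>
    rw [hf.apply_inv]
    split_ifs
    · exact neg_mem hx
    · exact hx

/-- For a finitely generated group, real cocycles can be made integral. -/
theorem exists_int [Group.FG G] {f : G → ℝ} (hf : IsSignCocycle ε f) {g : G} (hg : f g ≠ 0) :
    ∃ f' : G → ℤ, IsSignCocycle ε f' ∧ f' g ≠ 0 := by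
  obtain ⟨S, hS⟩ := Group.FG.out (G := G)
  set B := AddSubgroup.closure (f '' S) with hB
  have hmem := hf.mem_closure hS
  have : Module.Finite ℤ B := by
    classical
    have : B.FG := ⟨S.image f, by rw [hB, Finset.coe_image]⟩
    rw [Module.Finite.iff_addGroup_fg]
    exact (AddGroup.fg_iff_addSubgroup_fg B).2 this
  have hfB : IsSignCocycle ε fun a => (⟨f a, hmem a⟩ : B) := by
    intro a b
    apply Subtype.ext
    have := hf a b
    split_ifs at this ⊢ <;> simpa using this
  have hne : (⟨f g, hmem g⟩ : B) ≠ 0 := fun h => hg (congrArg Subtype.val h)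
  -- The span `B` of the values is finitely generated and torsion-free, hence free, so a functional
  -- to `ℤ` detects `f g`.
  rw [Ne, ← Module.forall_dual_apply_eq_zero_iff ℤ] at hne
  push Not at hne
  obtain ⟨l, hl⟩ := hne
  exact ⟨_, hfB.comp_addMonoidHom l.toAddMonoidHom, hl⟩

/-- A nonzero integral cocycle can be changed, by a coboundary and a division, to one that maps
the kernel of the sign onto `ℤ` and that vanishes at some element of negative sign, if any. -/
theorem exists_surjective {f : G → ℤ} (hf : IsSignCocycle ε f) {g : G} (hεg : ε g = 1)
    (hg : f g ≠ 0) : ∃ f' : G → ℤ, IsSignCocycle ε f' ∧ (∀ n, ∃ a, ε a = 1 ∧ f' a = n) ∧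
      ((∃ t, ε t ≠ 1) → ∃ t, ε t ≠ 1 ∧ f' t = 0) := by
  obtain ⟨c, hc⟩ : ∃ c, ∀ t, ε t ≠ 1 → ∃ t', ε t' ≠ 1 ∧ f t' = c := by
    by_cases h : ∃ t, ε t ≠ 1
    · obtain ⟨t, ht⟩ := h
      exact ⟨f t, fun _ _ => ⟨t, ht, rfl⟩⟩
    · exact ⟨0, fun t ht => absurd ⟨t, ht⟩ h⟩
  let B : AddSubgroup ℤ :=
    { carrier := {n | ∃ a, ε a = 1 ∧ f a = n}
      zero_mem' := ⟨1, map_one ε, hf.apply_one⟩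
      add_mem' := by
        rintro _ _ ⟨a, ha, rfl⟩ ⟨b, hb, rfl⟩
        exact ⟨a * b, by rw [map_mul, ha, hb, one_mul], by rw [hf, if_pos ha]⟩
      neg_mem' := by
        rintro _ ⟨a, ha, rfl⟩
        exact ⟨a⁻¹, by rw [map_inv, ha, inv_one], by rw [hf.apply_inv, if_pos ha]⟩ }
  obtain ⟨⟨d, hdB⟩, hd⟩ := IsAddCyclic.exists_generator (α := B)
  have hdvd (n : ℤ) (hn : n ∈ B) : ∃ k, n = d * k := by
    obtain ⟨k, hk⟩ := AddSubgroup.mem_zmultiples_iff.1 (hd ⟨n, hn⟩)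
    refine ⟨k, ?_⟩
    have := congrArg Subtype.val hk
    simp only [AddSubgroup.coe_zsmul, smul_eq_mul] at this
    rw [← this, mul_comm]
  have hd0 : d ≠ 0 := by
    rintro rfl
    obtain ⟨k, hk⟩ := hdvd (f g) ⟨g, hεg, rfl⟩
    exact hg (by rw [hk, zero_mul])
  -- Subtracting `c` at negative signs moves the origin to `c / 2`, the point fixed by a reflection
  -- with value `c`. The new values lie in `B = dℤ`.
  have hex (a : G) : ∃ k, (if ε a = 1 then f a else f a - c) = d * k := by
    apply hdvd
    split_ifs with ha
    · exact ⟨a, ha, rfl⟩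
    · obtain ⟨t, ht, rfl⟩ := hc a ha
      refine ⟨a * t⁻¹, ?_, ?_⟩
      · rw [map_mul, mul_eq_one_iff_ne_of_ne ha, map_inv]
        exact inv_ne_one.2 ht
      · rw [hf, if_neg ha, hf.apply_inv, if_neg ht, sub_eq_add_neg]
  choose f' hf' using hex
  refine ⟨f', fun a b => ?_, fun n => ?_, fun ⟨t, ht⟩ => ?_⟩
  · apply mul_left_cancel₀ hd0
    have h₁ := hf a b
    have h₂ := hf' a
    have h₃ := hf' b
    rw [← hf' (a * b), map_mul]
    by_cases ha : ε a = 1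
    · simp only [ha, one_mul, if_true] at *
      split_ifs at * <;> linarith
    · simp only [ha, if_false, mul_eq_one_iff_ne_of_ne ha, ite_not] at *
      split_ifs at * <;> linarith
  · obtain ⟨a, ha, han⟩ := B.zsmul_mem hdB n
    refine ⟨a, ha, mul_left_cancel₀ hd0 ?_⟩
    rw [← hf' a, if_pos ha, han, smul_eq_mul, mul_comm]
  · obtain ⟨t', ht', htc⟩ := hc t ht
    refine ⟨t', ht', mul_left_cancel₀ hd0 ?_⟩
    rw [← hf' t', if_neg ht', htc, sub_self, mul_zero]

/-- The action on the line given by a real cocycle. -/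
noncomputable def lineAction {f : G → ℝ} (hf : IsSignCocycle ε f) :
    G →* (ULift.{v} ℝ ≃ᵢ ULift.{v} ℝ) where
  toFun a := IsometryEquiv.mk' (fun s => ⟨f a + if ε a = 1 then s.down else -s.down⟩)
    (fun s => ⟨f a⁻¹ + if ε a = 1 then s.down else -s.down⟩)
    (fun s => by
      apply ULift.ext
      rw [hf.apply_inv]
      split_ifs <;> simp)
    (Isometry.of_dist_eq fun s t => by
      rw [ULift.dist_eq, ULift.dist_eq, Real.dist_eq, Real.dist_eq]
      split_ifs
      · congr 1
        ring
      · rw [abs_sub_comm]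
        congr 1
        ring)
  map_one' := by
    ext s
    simp [IsometryEquiv.mk', hf.apply_one]
  map_mul' a b := by
    ext s
    by_cases ha : ε a = 1
    · simp [IsometryEquiv.mk', hf a b, ha, add_assoc]
    · by_cases hb : ε b = 1 <;>
        simp [IsometryEquiv.mk', hf a b, ha, hb, mul_eq_one_iff_ne_of_ne ha] <;> ring

theorem lineAction_apply {f : G → ℝ} (hf : IsSignCocycle ε f) (a : G) (s : ULift.{v} ℝ) :
    hf.lineAction a s = ⟨f a + if ε a = 1 then s.down else -s.down⟩ :=
  rfl

theorem apply_zpow {f : G → ℝ} (hf : IsSignCocycle ε f) {g : G} (hg : ε g = 1) (n : ℤ) :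
    f (g ^ n) = n * f g := by
  obtain ⟨n, rfl | rfl⟩ := n.eq_nat_or_neg
  · rw [zpow_natCast, hf.apply_pow hg, nsmul_eq_mul, Int.cast_natCast]
  · rw [zpow_neg, zpow_natCast, hf.apply_inv, map_pow, hg, one_pow, if_pos rfl, hf.apply_pow hg,
      nsmul_eq_mul]
    push_cast
    ring

theorem isLoxodromic_lineAction {f : G → ℝ} (hf : IsSignCocycle ε f) {g : G} (hε : ε g = 1)
    (hg : f g ≠ 0) : IsLoxodromic (hf.lineAction.{u, v} g) := by
  have hpos := abs_pos.2 hg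
  refine ⟨⟨0⟩, max 1 (max |f g| |f g|⁻¹), 0, le_max_left _ _, le_rfl, fun n m => ?_⟩
  have happ (n : ℤ) : (hf.lineAction.{u, v} g ^ n) ⟨0⟩ = ⟨n * f g⟩ := by
    rw [← map_zpow, lineAction_apply, hf.apply_zpow hε, map_zpow, hε, one_zpow]
    simp
  have hd : dist ((hf.lineAction.{u, v} g ^ n) ⟨0⟩) ((hf.lineAction.{u, v} g ^ m) ⟨0⟩) =
      |f g| * dist n m := by
    rw [happ, happ, ULift.dist_eq, Real.dist_eq, Int.dist_eq, ← abs_mul]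
    congr 1
    ring
  rw [hd, sub_zero, add_zero]
  refine ⟨?_, ?_⟩
  · rw [div_le_iff₀ (by positivity)]
    calc dist n m = |f g| * dist n m * |f g|⁻¹ := by field_simp
      _ ≤ _ := by
        gcongr
        exact (le_max_right _ _).trans (le_max_right _ _)
  · gcongr
    exact (le_max_left _ _).trans (le_max_right _ _)

theorem not_nl {f : G → ℝ} (hf : IsSignCocycle ε f) {g : G} (hε : ε g = 1) (hg : f g ≠ 0) :
    ¬ NL.{u, v} G :=
  fun h => h _ hf.lineAction g (hf.isLoxodromic_lineAction hε hg)

end IsSignCocycle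

/-- `G` acts on the line by a homomorphism to `ℝ ⋊ ℤ/2` whose image contains a nontrivial
translation. -/
def HasTranslation (G : Type u) [Group G] : Prop :=
  ∃ (ε : G →* Multiplicative (ZMod 2)) (f : G → ℝ), IsSignCocycle ε f ∧ ∃ g, ε g = 1 ∧ f g ≠ 0

theorem HasTranslation.not_nl (h : HasTranslation G) : ¬ NL.{u, v} G := by
  obtain ⟨ε, f, hf, g, hε, hg⟩ := h
  exact hf.not_nl hε hg

theorem IsAmenableGroup.nl_iff (hG : IsAmenableGroup G) : NL.{u, v} G ↔ ¬ HasTranslation G := by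
  refine ⟨fun h h' => h'.not_nl h, fun h X _ _ ρ k hk => h ?_⟩
  exact hG.exists_isSignCocycle_of_isLoxodromic hk

/-- A translation `g` gives three distinct images, those of `1`, `g` and `g ^ 2`. Without
translations the image injects into `ℤ/2`. -/
theorem smallImages_iff : SmallImages G ↔ ¬ HasTranslation G := by
  constructor
  · rintro h ⟨ε, f, hf, g, hε, hg⟩
    let ψ : G →* RealSemidirectZ2 :=
      { toFun := fun a => ⟨Multiplicative.ofAdd (f a), ε a⟩
        map_one' := by rw [hf.apply_one, map_one]; rfl
        map_mul' := fun a b => by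
          refine SemidirectProduct.ext ?_ (map_mul ε a b)
          rw [SemidirectProduct.mul_left]
          change f (a * b) = f a + Multiplicative.toAdd ((signAction (ε a)) (.ofAdd (f b)))
          rw [hf a b]
          by_cases ha : ε a = 1 <;> simp [signAction, ha] }
    have hψ (a : G) : (ψ a).left.toAdd = f a := rfl
    have hne {a b : G} (hab : f a ≠ f b) : ψ a ≠ ψ b := fun he => hab (by rw [← hψ, he, hψ])
    have hsub : ({ψ 1, ψ g, ψ (g ^ 2)} : Set RealSemidirectZ2) ⊆ Set.range ψ := by
      rintro _ (rfl | rfl | rfl) <;> exact Set.mem_range_self _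
    have h3 : ({ψ 1, ψ g, ψ (g ^ 2)} : Set RealSemidirectZ2).encard = 3 := by
      have h2 := hf.apply_pow hε 2
      rw [two_smul] at h2
      refine Set.encard_eq_three.2 ⟨_, _, _, hne ?_, hne ?_, hne ?_, rfl⟩
      · rw [hf.apply_one]
        exact hg.symm
      · rw [hf.apply_one, h2]
        intro h0
        exact hg (by linarith)
      · rw [h2]
        intro h0
        exact hg (by linarith)
    have := (Set.encard_le_encard hsub).trans (h ψ)
    rw [h3] at this
    exact absurd this (by norm_num)
  · intro h ψ
    have hf : IsSignCocycle (SemidirectProduct.rightHom.comp ψ) fun a => (ψ a).left.toAdd := by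
      intro a b
      change (ψ (a * b)).left.toAdd = (ψ a).left.toAdd +
        if (ψ a).right = 1 then (ψ b).left.toAdd else -(ψ b).left.toAdd
      rw [map_mul, SemidirectProduct.mul_left]
      by_cases ha : (ψ a).right = 1 <;> simp [signAction, ha]
    have hinj : Set.InjOn SemidirectProduct.right (Set.range ψ) := by
      rintro _ ⟨a, rfl⟩ _ ⟨b, rfl⟩ hab
      have hr : (ψ (a * b⁻¹)).right = 1 := by
        rw [map_mul, map_inv, SemidirectProduct.mul_right, SemidirectProduct.inv_right, hab,
          mul_inv_cancel]
      have hl : (ψ (a * b⁻¹)).left.toAdd = 0 := by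
        by_contra hne
        exact h ⟨_, _, hf, _, hr, hne⟩
      have : ψ (a * b⁻¹) = 1 := SemidirectProduct.ext hl hr
      rwa [map_mul, map_inv, mul_inv_eq_one] at this
    refine (Set.encard_le_encard_of_injOn (Set.mapsTo_univ _ _) hinj).trans ?_
    rw [Set.encard_univ]
    simp

/-- The homomorphism `D_∞ → ℤ/2` that is nontrivial exactly on the reflections. -/
def dihedralSign : DihedralGroup 0 →* Multiplicative (ZMod 2) where
  toFun
    | .r _ => 1
    | .sr _ => .ofAdd 1
  map_one' := rfl
  map_mul' := by
    have h : (1 : Multiplicative (ZMod 2)) = .ofAdd 1 * .ofAdd 1 := by decide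
    rintro (i | i) (j | j)
    · rfl
    · rfl
    · rfl
    · exact h

/-- The orbit map of `0` for the action of `D_∞` on the line. -/
noncomputable def dihedralTranslation : DihedralGroup 0 → ℝ
  | .r i => ZMod.castHom (dvd_refl 0) ℝ i
  | .sr i => -ZMod.castHom (dvd_refl 0) ℝ i

theorem isSignCocycle_dihedralTranslation : IsSignCocycle dihedralSign dihedralTranslation := by
  have hr (i : ZMod 0) : dihedralSign (.r i) = 1 := rfl
  have hsr (i : ZMod 0) : dihedralSign (.sr i) ≠ 1 :=
    show (Multiplicative.ofAdd (1 : ZMod 2)) ≠ 1 by decide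
  rintro (i | i) (j | j)
  · rw [DihedralGroup.r_mul_r, if_pos (hr i)]
    simp only [dihedralTranslation, map_add]
  · rw [DihedralGroup.r_mul_sr, if_pos (hr i)]
    simp only [dihedralTranslation, map_sub]
    ring
  · rw [DihedralGroup.sr_mul_r, if_neg (hsr i)]
    simp only [dihedralTranslation, map_add]
    ring
  · rw [DihedralGroup.sr_mul_sr, if_neg (hsr i)]
    simp only [dihedralTranslation, map_sub]
    ring

theorem HasTranslation.of_surjectsOnto (h : SurjectsOntoZOrDInfty G) : HasTranslation G := by
  rcases h with ⟨F, hF⟩ | ⟨F, hF⟩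
  · obtain ⟨g, hg⟩ := hF (Multiplicative.ofAdd 1)
    refine ⟨1, fun a => ((F a).toAdd : ℝ), fun a b => ?_, g, rfl, ?_⟩
    · simp
    · simp [hg]
  · obtain ⟨g, hg⟩ := hF (DihedralGroup.r 1)
    refine ⟨dihedralSign.comp F, fun a => dihedralTranslation (F a), fun a b => ?_, g, ?_, ?_⟩
    · dsimp only
      rw [map_mul]
      exact isSignCocycle_dihedralTranslation _ _
    · rw [MonoidHom.comp_apply, hg]
      rfl
    · dsimp only
      rw [hg, dihedralTranslation, map_one]
      exact one_ne_zero

theorem HasTranslation.surjectsOnto [Group.FG G] (h : HasTranslation G) :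
    SurjectsOntoZOrDInfty G := by
  obtain ⟨ε, f, hf, g, hε, hg⟩ := h
  obtain ⟨f, hf, hg⟩ := hf.exists_int hg
  obtain ⟨f, hf, hsurj, hflip⟩ := hf.exists_surjective hε hg
  by_cases ht : ∃ t, ε t ≠ 1
  · right
    obtain ⟨t, ht, hft⟩ := hflip ht
    obtain ⟨c, hc⟩ : ∃ c : ℤ →+* ZMod 0, Function.Surjective c :=
      ⟨Int.castRingHom (ZMod 0), ZMod.intCast_surjective⟩
    -- In the convention of `dihedralTranslation`, `sr i` sends 0 to `-i`; hence the sign.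
    refine ⟨⟨⟨fun a => if ε a = 1 then .r (c (f a)) else .sr (-c (f a)), ?_⟩, fun a b => ?_⟩, ?_⟩
    · rw [map_one, if_pos rfl, hf.apply_one, map_zero]
      rfl
    · dsimp only
      rw [hf a b, map_mul]
      by_cases ha : ε a = 1
      · by_cases hb : ε b = 1 <;> simp [ha, hb, sub_eq_add_neg, add_comm]
      · by_cases hb : ε b = 1 <;>
          simp [ha, hb, mul_eq_one_iff_ne_of_ne ha, sub_eq_add_neg, add_comm]
    · rintro (i | i)
      · obtain ⟨n, rfl⟩ := hc i
        obtain ⟨a, ha, rfl⟩ := hsurj n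
        exact ⟨a, if_pos ha⟩
      · obtain ⟨n, rfl⟩ := hc i
        obtain ⟨a, ha, han⟩ := hsurj (-n)
        refine ⟨a * t, ?_⟩
        simp [ha, ht, hf a t, hft, han]
  · left
    push Not at ht
    refine ⟨⟨⟨fun a => .ofAdd (f a), ?_⟩, fun a b => ?_⟩, fun n => ?_⟩
    · rw [hf.apply_one]
      rfl
    · dsimp only
      rw [hf a b, if_pos (ht a)]
      rfl
    · obtain ⟨a, -, ha⟩ := hsurj n.toAdd
      exact ⟨a, ha⟩

end SignCocycle

/-! ### Subgroups of amenable groups -/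

section Amenable

theorem IsAmenableGroup.subgroup {G : Type u} [Group G] (hG : IsAmenableGroup G)
    (H : Subgroup G) : IsAmenableGroup H := by
  obtain ⟨m, hm, hinv⟩ := hG.exists_mean
  -- With right coset representatives, `g ↦ g * (rep g)⁻¹` is a left `H`-equivariant map `G → H`,
  -- which carries the mean over.
  let rep : G → G := fun g => (Quotient.mk (QuotientGroup.rightRel H) g).out
  have hrep (g : G) : g * (rep g)⁻¹ ∈ H := by
    rw [← QuotientGroup.rightRel_apply]
    exact Quotient.exact (Quotient.out_eq (Quotient.mk (QuotientGroup.rightRel H) g))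
  have hmul (h : H) (g : G) : rep (h * g) = rep g := by
    refine congrArg Quotient.out (Quotient.sound ?_)
    change QuotientGroup.rightRel H (h * g) g
    rw [QuotientGroup.rightRel_apply]
    simp
  refine (hm.comap fun g => (⟨g * (rep g)⁻¹, hrep g⟩ : H)).isAmenableGroup fun h s => ?_
  refine Eq.trans (congrArg m ?_) (hinv h _)
  ext g
  simp only [Set.mem_preimage]
  rw [iff_iff_eq]
  congr 1
  apply Subtype.ext
  simp [hmul, mul_assoc]

end Amenable

/-! ### Abelian and nilpotent groups -/

section Torsion

open scoped commutatorElement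

variable {G : Type u} [Group G]

theorem nl_of_isOfFinOrder (h : ∀ g : G, IsOfFinOrder g) : NL.{u, v} G := by
  rintro X _ _ ρ g ⟨x, K, C, hK, hC, hqi⟩
  obtain ⟨n, hn, hgn⟩ := isOfFinOrder_iff_pow_eq_one.1 (h g)
  obtain ⟨j, hj⟩ := exists_nat_gt (K * C)
  have h₁ := (hqi ((n * j : ℕ) : ℤ) 0).1
  have h₂ : (ρ g ^ (((n * j : ℕ) : ℤ))) x = x := by
    rw [zpow_natCast, ← map_pow, pow_mul, hgn, one_pow, map_one]
    rfl
  dsimp only at h₁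
  rw [h₂, zpow_zero, Int.dist_eq] at h₁
  simp only [IsometryEquiv.coe_one, id, dist_self] at h₁
  have h₃ : (j : ℝ) ≤ n * j := by
    exact_mod_cast Nat.le_mul_of_pos_left j hn
  rw [sub_nonpos, div_le_iff₀ (by linarith)] at h₁
  push_cast at h₁
  rw [sub_zero, abs_of_nonneg (by positivity)] at h₁
  linarith

theorem not_nl_of_hom (f : G →* Multiplicative ℝ) {g : G} (hg : f g ≠ 1) : ¬ NL.{u, v} G :=
  HasTranslation.not_nl ⟨1, fun a => (f a).toAdd, fun a b => by simp, g, rfl, hg⟩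

/-- `ℝ` is divisible, hence an injective `ℤ`-module, so the embedding of `⟨g⟩ ≅ ℤ` extends. -/
theorem exists_hom_real_of_not_isOfFinOrder {G : Type u} [CommGroup G] {g : G}
    (hg : ¬ IsOfFinOrder g) : ∃ f : G →* Multiplicative ℝ, f g ≠ 1 := by
  have hinj : Function.Injective (zmultiplesHom (Additive G) (Additive.ofMul g)) := by
    intro m n hmn
    exact injective_zpow_iff_not_isOfFinOrder.2 hg hmn
  obtain ⟨F, hF⟩ := Module.Baer.extension_property_addMonoidHom (Module.Baer.of_divisible ℝ)
    (zmultiplesHom (Additive G) (Additive.ofMul g)) hinj (Int.castAddHom ℝ)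
  refine ⟨AddMonoidHom.toMultiplicativeRight F, fun h => ?_⟩
  have := DFunLike.congr_fun hF 1
  simp at this
  have h' : F (Additive.ofMul g) = 0 := h
  rw [h'] at this
  exact zero_ne_one this

theorem pow_mul_eq_of_commute {c p q : G} (hc : Commute c p) (h : p * q = c * (q * p)) (n : ℕ) :
    p ^ n * q = c ^ n * (q * p ^ n) := by
  induction n with
  | zero => simp
  | succ n ih =>
    rw [pow_succ', mul_assoc, ih, ← mul_assoc p, ← (hc.pow_left n).eq, mul_assoc, ← mul_assoc p, h,
      pow_succ]
    simp only [mul_assoc]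

/-- Modulo the next term, `⁅p, q⁆ ^ n = ⁅p ^ n, q⁆`, which is trivial once `p ^ n` has dropped a
step. The quotient of successive terms is central, so torsion passes from these generators to
products. -/
theorem exists_pow_mem_lowerCentralSeries_succ
    (h : ∀ g : G, ∃ n > 0, g ^ n ∈ commutator G) (i : ℕ) :
    ∀ a ∈ (⊤ : Subgroup G).lowerCentralSeries i,
      ∃ n > 0, a ^ n ∈ (⊤ : Subgroup G).lowerCentralSeries (i + 1) := by
  induction i with
  | zero =>
    intro a _
    rw [zero_add, Subgroup.top_lowerCentralSeries_one]
    exact h a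
  | succ i ih =>
    set L := (⊤ : Subgroup G).lowerCentralSeries
    have hL (j : ℕ) : L (j + 1) = ⁅L j, ⊤⁆ := Subgroup.lowerCentralSeries_succ _ _
    have hN : (L (i + 1 + 1)).Normal := inferInstance
    have hcomm (a : G) (ha : a ∈ L (i + 1)) (b : G) :
        Commute (a : G ⧸ L (i + 1 + 1)) (b : G ⧸ L (i + 1 + 1)) := by
      rw [← commutatorElement_eq_one_iff_commute]
      refine (QuotientGroup.eq_one_iff ⁅a, b⁆).2 ?_
      rw [hL]
      exact Subgroup.commutator_mem_commutator ha (Subgroup.mem_top b)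
    intro a ha
    have hcl := ha
    rw [hL, Subgroup.commutator_def] at hcl
    have hle : ∀ x ∈ Subgroup.closure {g | ∃ g₁ ∈ L i, ∃ g₂ ∈ (⊤ : Subgroup G), ⁅g₁, g₂⁆ = g},
        x ∈ L (i + 1) := fun x hx => by rwa [hL, Subgroup.commutator_def]
    clear ha
    induction hcl using Subgroup.closure_induction with
    | mem x hx =>
      obtain ⟨p, hp, q, -, rfl⟩ := hx
      obtain ⟨n, hn, hpn⟩ := ih p hp
      refine ⟨n, hn, ?_⟩
      rw [← QuotientGroup.eq_one_iff]
      have hc : ⁅p, q⁆ ∈ L (i + 1) := by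
        rw [hL]
        exact Subgroup.commutator_mem_commutator hp (Subgroup.mem_top q)
      have hpq : (p * q : G ⧸ L (i + 1 + 1)) = (⁅p, q⁆ : G) * (q * p) := by
        simp only [← QuotientGroup.mk_mul, commutatorElement_def]
        congr 1
        group
      have h₁ := pow_mul_eq_of_commute (hcomm _ hc p) hpq n
      have h₂ := (hcomm _ hpn q).eq
      simp only [QuotientGroup.mk_pow] at h₂ ⊢
      rw [h₂] at h₁
      exact mul_eq_right.1 h₁.symm
    | one => exact ⟨1, one_pos, by simp⟩
    | mul x y hx hy ihx ihy =>
      obtain ⟨n, hn, hxn⟩ := ihx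
      obtain ⟨k, hk, hyk⟩ := ihy
      refine ⟨n * k, mul_pos hn hk, ?_⟩
      rw [← QuotientGroup.eq_one_iff] at hxn hyk ⊢
      rw [QuotientGroup.mk_pow] at hxn hyk ⊢
      rw [QuotientGroup.mk_mul, (hcomm x (hle x hx) y).mul_pow, pow_mul, hxn, one_pow, one_mul,
        mul_comm n k, pow_mul, hyk, one_pow]
    | inv x hx ihx =>
      obtain ⟨n, hn, hxn⟩ := ihx
      exact ⟨n, hn, by rw [inv_pow]; exact inv_mem hxn⟩

theorem isOfFinOrder_of_isNilpotent (hG : Group.IsNilpotent G)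
    (h : ∀ g : G, ∃ n > 0, g ^ n ∈ commutator G) (g : G) : IsOfFinOrder g := by
  obtain ⟨c, hc⟩ := Subgroup.nilpotent_iff_lowerCentralSeries.1 hG
  have key (i : ℕ) : ∃ n > 0, g ^ n ∈ (⊤ : Subgroup G).lowerCentralSeries i := by
    induction i with
    | zero => exact ⟨1, one_pos, Subgroup.mem_top _⟩
    | succ i ih =>
      obtain ⟨n, hn, hgn⟩ := ih
      obtain ⟨k, hk, hgk⟩ := exists_pow_mem_lowerCentralSeries_succ h i _ hgn
      exact ⟨n * k, mul_pos hn hk, by rwa [pow_mul]⟩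
  obtain ⟨n, hn, hgn⟩ := key c
  rw [hc, Subgroup.mem_bot] at hgn
  exact isOfFinOrder_iff_pow_eq_one.2 ⟨n, hn, hgn⟩

theorem nl_iff_of_isNilpotent (hG : Group.IsNilpotent G) :
    NL.{u, v} G ↔ ∀ f : G →* Multiplicative ℝ, f = 1 := by
  refine ⟨fun h f => ?_, fun h => nl_of_isOfFinOrder
    (isOfFinOrder_of_isNilpotent hG fun g => ?_)⟩
  · by_contra hf
    obtain ⟨g, hg⟩ := DFunLike.ne_iff.1 hf
    exact not_nl_of_hom f hg h
  · have hfin : IsOfFinOrder (Abelianization.of g) := by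
      by_contra hinf
      obtain ⟨f, hf⟩ := exists_hom_real_of_not_isOfFinOrder hinf
      exact hf (DFunLike.congr_fun (h (f.comp Abelianization.of)) g)
    obtain ⟨n, hn, hgn⟩ := isOfFinOrder_iff_pow_eq_one.1 hfin
    refine ⟨n, hn, ?_⟩
    rw [← map_pow] at hgn
    rwa [← Abelianization.ker_of, MonoidHom.mem_ker]

end Torsion

/-! ### The proposition -/

theorem proposition3p1 :
    (∀ (G : Type u) [Group G], IsAmenableGroup G →
      NGT.{u, v} G ∧
      (NL.{u, v} G ↔ SmallImages G) ∧
      (HereditaryNL.{u, v} G ↔ ∀ H : Subgroup G, H.FiniteIndex → SmallImages H) ∧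
      (Group.FG G →
        (NL.{u, v} G ↔ ¬ SurjectsOntoZOrDInfty G) ∧
        (HereditaryNL.{u, v} G ↔
          ¬ ∃ H : Subgroup G, H.FiniteIndex ∧ SurjectsOntoZOrDInfty H))) ∧
    (∀ (G : Type u) [CommGroup G], NL.{u, v} G ↔ ∀ g : G, IsOfFinOrder g) ∧
    (∀ (G : Type u) [Group G], Group.IsNilpotent G →
      (NL.{u, v} G ↔ ∀ f : G →* Multiplicative ℝ, f = 1)) := by
  refine ⟨fun G _ hG => ⟨hG.ngt, ?_, ?_, fun hfg => ⟨?_, ?_⟩⟩, fun G _ => ?_,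
    fun G _ hG => nl_iff_of_isNilpotent hG⟩
  · rw [hG.nl_iff, smallImages_iff]
  · refine forall₂_congr fun H _ => ?_
    rw [(hG.subgroup H).nl_iff, smallImages_iff]
  · rw [hG.nl_iff]
    exact not_congr ⟨fun h => h.surjectsOnto, .of_surjectsOnto⟩
  · push Not
    refine forall₂_congr fun H hH => ?_
    rw [(hG.subgroup H).nl_iff]
    have : Group.FG H := Subgroup.fg_of_index_ne_zero H
    exact not_congr ⟨fun h => h.surjectsOnto, .of_surjectsOnto⟩
  · refine ⟨fun h g => ?_, nl_of_isOfFinOrder⟩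
    by_contra hg
    obtain ⟨f, hf⟩ := exists_hom_real_of_not_isOfFinOrder hg
    exact not_nl_of_hom f hf h
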